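/- Let $n,k\ge 1$ be integers and let $f:\mathbb{R}\to\mathbb{R}$ be a continuous $2\pi$-periodic function that is orthogonal to the trigonometric polynomials of degree at most $n-1$, i.e. $\int_{-\pi}^{\pi} f(x)\tau(x)\,dx=0$ for every real trigonometric polynomial $\tau$ of degree $\le n-1$. Let $\|g\|=\sup_{x\in\mathbb{R}}|g(x)|$ denote the uniform norm and put $$\omega_{2k}(f,\delta)=\sup_{0<t\le\delta}\Big\|\sum_{i=0}^{2k}(-1)^i\binom{2k}{i}f(\cdot+it)\Big\|\quad(\delta>0),\qquad \gamma_{2k}^*=\binom{2k}{k}^{-1},$$ $$\mu_{2k}\ge 0,\qquad \mu_{2k}^2=\frac{8}{\pi^2}\sum_{\substack{1\le i\le k\\ i\ \mathrm{odd}}}\frac{a_i}{i^2},\qquad a_i=\binom{2k}{k+i}\Big/\binom{2k}{k}.$$ (i) For every real $\alpha>1$, $$\|f\|\le\Big(\cos\frac{\pi}{2\alpha}\Big)^{-1}\gamma_{2k}^*\,\omega_{2k}\Big(f,\frac{\alpha\pi}{n}\Big).$$ (ii) More generally, for every real $h>\frac{\pi}{n}\mu_{2k}$, the number $\rho=\frac{\pi\mu_{2k}}{nh}$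 satisfies $\rho<1$, and $$\|f\|\le\Big(\cos\frac{\pi\rho}{2}\Big)^{-1}\gamma_{2k}^*\,\omega_{2k}(f,h).$$ -/

import Mathlib

namespace BohrFavard

/-- The uniform norm `‖f‖ = sup_x |f x|` of a (bounded) function on the line. -/
noncomputable def supNorm (f : ℝ → ℝ) : ℝ := ⨆ x : ℝ, |f x|

/-- `τ ∈ T_m`: `τ` is a real trigonometric polynomial of degree at most `m`. -/
def IsTrigPoly (m : ℕ) (τ : ℝ → ℝ) : Prop :=
  ∃ a b : ℕ → ℝ, ∀ x : ℝ,
    τ x = ∑ j ∈ Finset.range (m + 1), (a j * Real.cos (j * x) + b j * Real.sin (j * x))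

/-- `f ∈ T_m^⊥`: `f` is orthogonal to all trigonometric polynomials of degree at most `m`. -/
def OrthTrigPoly (m : ℕ) (f : ℝ → ℝ) : Prop :=
  ∀ τ : ℝ → ℝ, IsTrigPoly m τ → ∫ x in (-Real.pi)..Real.pi, f x * τ x = 0

/-- The forward difference `Δ_h^r(f, x) = ∑_{i=0}^r (-1)^i (r choose i) f (x + i h)`. -/
noncomputable def fwdDelta (r : ℕ) (h : ℝ) (f : ℝ → ℝ) (x : ℝ) : ℝ :=
  ∑ i ∈ Finset.range (r + 1), (-1 : ℝ) ^ i * (r.choose i : ℝ) * f (x + i * h)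

/-- The modulus of smoothness `ω_r(f, δ) = sup_{0 < h ≤ δ} ‖Δ_h^r(f, ·)‖`, for `δ > 0`. -/
noncomputable def modulus (r : ℕ) (f : ℝ → ℝ) (δ : ℝ) : ℝ :=
  sSup ((fun h : ℝ => supNorm (fwdDelta r h f)) '' Set.Ioc 0 δ)

/-- `γ_r^* = 1 / (r choose ⌊r/2⌋)`; in particular `γ_{2k}^* = 1 / (2k choose k)`. -/
noncomputable def gammaStar (r : ℕ) : ℝ := 1 / (r.choose (r / 2) : ℝ)

/-- `μ_{2k}`, the nonnegative root of
`μ_{2k}² = (8/π²) ∑_{1 ≤ i ≤ k, i odd} a_i / i²`, `a_i = (2k choose k+i) / (2k choose k)`. -/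
noncomputable def mu (k : ℕ) : ℝ :=
  Real.sqrt (8 / Real.pi ^ 2 *
    ∑ i ∈ (Finset.Icc 1 k).filter (fun i => Odd i),
      (((2 * k).choose (k + i) : ℝ) / ((2 * k).choose k : ℝ)) / (i : ℝ) ^ 2)

/-! For continuous periodic functions the suprema above are taken over bounded sets. -/

theorem bddAbove_abs {f : ℝ → ℝ} (hf : Continuous f)
    (hper : Function.Periodic f (2 * Real.pi)) : BddAbove (Set.range fun x : ℝ => |f x|) := by
  have hp : Function.Periodic (fun x => |f x|) (2 * Real.pi) := fun x => by
    simp only [hper x]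
  exact (hp.compact_of_continuous (by positivity) hf.abs).bddAbove

theorem abs_le_supNorm {f : ℝ → ℝ} (hf : Continuous f)
    (hper : Function.Periodic f (2 * Real.pi)) (x : ℝ) : |f x| ≤ supNorm f :=
  le_ciSup (bddAbove_abs hf hper) x

theorem supNorm_fwdDelta_le {f : ℝ → ℝ} (hf : Continuous f)
    (hper : Function.Periodic f (2 * Real.pi)) (r : ℕ) (h : ℝ) :
    supNorm (fwdDelta r h f) ≤ ∑ i ∈ Finset.range (r + 1), (r.choose i : ℝ) * supNorm f := by
  refine ciSup_le fun x => ?_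
  refine (Finset.abs_sum_le_sum_abs _ _).trans (Finset.sum_le_sum fun i _ => ?_)
  rw [abs_mul, abs_mul, abs_pow, abs_neg, abs_one, one_pow, one_mul, Nat.abs_cast]
  exact mul_le_mul_of_nonneg_left (abs_le_supNorm hf hper _) (Nat.cast_nonneg _)

theorem bddAbove_modulus {f : ℝ → ℝ} (hf : Continuous f)
    (hper : Function.Periodic f (2 * Real.pi)) (r : ℕ) (δ : ℝ) :
    BddAbove ((fun h : ℝ => supNorm (fwdDelta r h f)) '' Set.Ioc 0 δ) := by
  refine ⟨∑ i ∈ Finset.range (r + 1), (r.choose i : ℝ) * supNorm f, ?_⟩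
  rintro _ ⟨h, -, rfl⟩
  exact supNorm_fwdDelta_le hf hper r h

end BohrFavard

namespace BohrFavard

open MeasureTheory AddCircle

/-! Average the central differences of order `2k`, normalized by `gammaStar (2 * k)`, over steps `t
∈ (0, h]` with weight `(2/h)(1 - t/h)`. The resulting `W f` has norm at most `γ* ω(f, h)`. The
middle coefficient is `1`, and the weight turns each pair of shifts `±i t` into a second difference
of step `i h` divided by `(i h j)²`. So `W` multiplies the `j`-th Fourier coefficient by `1 - v_j /
j²` (`averagedDiff_symbol`), where `v_j` is the multiplier of a combination `M` of second
differences with `‖M‖ ≤ c²`, `c = π μ / h` (`norm_secondDiff_diffWeight_le`).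

Thus `W = 1 - M I`, with `I` the double integration `j⁻²`. Orthogonality leaves only frequencies
`|j| ≥ n` in `f`, and `1 - M I` is inverted by a Neumann series. What matters is to bound each power
`I^(m+1)` directly, as Bohr and Favard did, rather than by `‖I‖^(m+1)`. Write `|j|^(-2m-2)` as the
integral of `t^(2m+1)/(2m+1)! · e^(-t|j|)`, and replace the Poisson kernel by one with the same
coefficients for `|j| ≥ n` but with the smaller `L¹` norm `κ(n t)` (`exists_inverse_power`).

Summing the bounds with factors `c^(2m+2)` builds the series of `c sinh(c t)` under the integral
against `κ(n t)`. That integral is `sec(π c / 2n) - 1` (`sum_moment_kappa_le`), and `c / n = ρ`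
gives (ii). Part (i) is the case `h = α π / n`, because `μ ≤ 1`. -/

instance fact_two_pi_pos : Fact (0 < 2 * Real.pi) := ⟨Real.two_pi_pos⟩

/-- The circle `ℝ / 2πℤ`. -/
abbrev Circ := AddCircle (2 * Real.pi)

/-! ### Fourier coefficients of continuous functions on the circle. -/

theorem integrable_circ (f : C(Circ, ℂ)) : Integrable f haarAddCircle :=
  (map_continuous f).integrable_of_hasCompactSupport (HasCompactSupport.of_compactSpace _)

theorem norm_fourier_apply (j : ℤ) (x : Circ) : ‖fourier j x‖ = 1 := by
  rw [fourier_apply]; exact Circle.norm_coe _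

/-- The difference has a trivially summable Fourier series, and a continuous function is the sum of
its series when the coefficients are summable. This turns operator identities into identities of
multipliers. -/
theorem eq_of_fourierCoeff_eq {f g : C(Circ, ℂ)}
    (h : ∀ j, fourierCoeff f j = fourierCoeff g j) : f = g := by
  have h0 : fourierCoeff (f - g : C(Circ, ℂ)) = 0 := by
    funext j
    have hi : ∀ u : C(Circ, ℂ), Integrable (fun x => fourier (-j) x • u x) haarAddCircle :=
      fun u => (integrable_circ u).fourier_smul (-j)
    have := h j
    simp only [fourierCoeff] at this ⊢
    simp only [ContinuousMap.coe_sub, Pi.sub_apply, smul_sub, Pi.zero_apply]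
    rw [integral_sub (hi f) (hi g), this, sub_self]
  have h1 := hasSum_fourier_series_of_summable (f := f - g) (by rw [h0]; exact summable_zero)
  rw [h0] at h1
  simp only [Pi.zero_apply, zero_smul] at h1
  exact sub_eq_zero.mp (h1.unique hasSum_zero)

theorem norm_mul_shift_le {Ω : Type*} {q : Ω → ℂ} {s : Ω → Circ} (f : C(Circ, ℂ)) (x : Circ)
    (ω : Ω) : ‖q ω * f (x + s ω)‖ ≤ ‖q ω‖ * ‖f‖ := by
  rw [norm_mul]
  exact mul_le_mul_of_nonneg_left (f.norm_coe_le_norm _) (norm_nonneg _)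

/-! ### Averages of translates as bounded operators. -/

section ShiftAverage

variable {Ω : Type*} [MeasurableSpace Ω] {ν : Measure Ω} {q : Ω → ℂ} {s : Ω → Circ}

theorem aestronglyMeasurable_mul_shift (hq : Integrable q ν) (hs : Measurable s)
    (f : C(Circ, ℂ)) (x : Circ) : AEStronglyMeasurable (fun ω => q ω * f (x + s ω)) ν :=
  hq.aestronglyMeasurable.mul
    (f.continuous.measurable.comp (measurable_const.add hs)).aestronglyMeasurable

theorem integrable_mul_shift (hq : Integrable q ν) (hs : Measurable s)
    (f : C(Circ, ℂ)) (x : Circ) : Integrable (fun ω => q ω * f (x + s ω)) ν :=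
  (hq.norm.mul_const ‖f‖).mono' (aestronglyMeasurable_mul_shift hq hs f x)
    (Filter.Eventually.of_forall fun ω => norm_mul_shift_le f x ω)

/-- The operator `f ↦ ∫ q(ω) f(· + s(ω)) dν(ω)` averaging translates of `f`. -/
noncomputable def shiftAverage (hq : Integrable q ν) (hs : Measurable s) :
    C(Circ, ℂ) →L[ℂ] C(Circ, ℂ) :=
  LinearMap.mkContinuous
    { toFun := fun f => ⟨fun x => ∫ ω, q ω * f (x + s ω) ∂ν,
        continuous_of_dominated (aestronglyMeasurable_mul_shift hq hs f)
          (fun x => Filter.Eventually.of_forall fun ω => norm_mul_shift_le f x ω)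
          (hq.norm.mul_const ‖f‖)
          (Filter.Eventually.of_forall fun ω => by fun_prop)⟩
      map_add' := fun f g => by
        ext x
        simp only [ContinuousMap.add_apply, ContinuousMap.coe_mk, mul_add]
        exact integral_add (integrable_mul_shift hq hs f x) (integrable_mul_shift hq hs g x)
      map_smul' := fun c f => by
        ext x
        simp only [ContinuousMap.smul_apply, ContinuousMap.coe_mk, smul_eq_mul, RingHom.id_apply]
        rw [← integral_const_mul]
        exact integral_congr_ae (Filter.Eventually.of_forall fun ω => by ring_nf) }
    (∫ ω, ‖q ω‖ ∂ν) fun f => by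
      refine (ContinuousMap.norm_le _ (by positivity)).2 fun x => ?_
      refine (norm_integral_le_of_norm_le (hq.norm.mul_const ‖f‖)
        (Filter.Eventually.of_forall fun ω => norm_mul_shift_le f x ω)).trans_eq ?_
      rw [integral_mul_const]

theorem shiftAverage_apply (hq : Integrable q ν) (hs : Measurable s) (f : C(Circ, ℂ)) (x : Circ) :
    shiftAverage hq hs f x = ∫ ω, q ω * f (x + s ω) ∂ν := rfl

theorem norm_shiftAverage_le (hq : Integrable q ν) (hs : Measurable s) :
    ‖shiftAverage hq hs‖ ≤ ∫ ω, ‖q ω‖ ∂ν :=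
  LinearMap.mkContinuous_norm_le _ (by positivity) _

theorem integral_fourier_mul_shift (f : C(Circ, ℂ)) (j : ℤ) (y : Circ) :
    ∫ x, fourier (-j) x * f (x + y) ∂haarAddCircle = fourier j y * fourierCoeff f j := by
  rw [← integral_add_right_eq_self (μ := haarAddCircle) (fun x => fourier (-j) x * f (x + y)) (-y),
    fourierCoeff, ← integral_const_mul]
  refine integral_congr_ae (Filter.Eventually.of_forall fun x => ?_)
  have : fourier (-j) (x + -y) = fourier (-j) x * fourier j y := by
    rw [fourier_apply, fourier_apply, fourier_apply, smul_add, toCircle_add, Circle.coe_mul]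
    simp
  simp only [this, neg_add_cancel_right, smul_eq_mul]
  ring

/-- Fubini and translation invariance of Haar measure. Every operator below is built from such
averages, so this computes all multipliers. -/
theorem fourierCoeff_shiftAverage [SFinite ν] (hq : Integrable q ν) (hs : Measurable s)
    (f : C(Circ, ℂ)) (j : ℤ) :
    fourierCoeff (shiftAverage hq hs f) j = (∫ ω, q ω * fourier j (s ω) ∂ν) * fourierCoeff f j := by
  have hint : Integrable (fun p : Circ × Ω => fourier (-j) p.1 * (q p.2 * f (p.1 + s p.2)))
      (haarAddCircle.prod ν) := by
    refine ((hq.norm.mul_const ‖f‖).comp_snd haarAddCircle).mono' ?_ ?_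
    · refine (((map_continuous _).measurable.comp measurable_fst).aestronglyMeasurable).mul
        (hq.aestronglyMeasurable.comp_snd.mul ?_)
      exact (f.continuous.measurable.comp
        (measurable_fst.add (hs.comp measurable_snd))).aestronglyMeasurable
    · refine Filter.Eventually.of_forall fun p => ?_
      rw [norm_mul, norm_fourier_apply, one_mul]
      exact norm_mul_shift_le f _ _
  calc fourierCoeff (shiftAverage hq hs f) j
      = ∫ x, ∫ ω, fourier (-j) x * (q ω * f (x + s ω)) ∂ν ∂haarAddCircle := by
        simp only [fourierCoeff, shiftAverage_apply, smul_eq_mul, integral_const_mul]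
    _ = ∫ ω, ∫ x, fourier (-j) x * (q ω * f (x + s ω)) ∂haarAddCircle ∂ν :=
        integral_integral_swap hint
    _ = ∫ ω, q ω * fourier j (s ω) * fourierCoeff f j ∂ν := by
        refine integral_congr_ae (Filter.Eventually.of_forall fun ω => ?_)
        simp only [mul_assoc]
        rw [← integral_fourier_mul_shift, ← integral_const_mul]
        exact integral_congr_ae (Filter.Eventually.of_forall fun x => by ring_nf)
    _ = _ := integral_mul_const _ _

end ShiftAverage

/-! ### Fourier multipliers and the Neumann expansion. -/

/-- `L` acts on Fourier coefficients as multiplication by `l`. -/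
def HasMultiplier (L : C(Circ, ℂ) →L[ℂ] C(Circ, ℂ)) (l : ℤ → ℂ) : Prop :=
  ∀ (f : C(Circ, ℂ)) (j : ℤ), fourierCoeff (L f) j = l j * fourierCoeff f j

theorem HasMultiplier.pow {L : C(Circ, ℂ) →L[ℂ] C(Circ, ℂ)} {l : ℤ → ℂ} (h : HasMultiplier L l)
    (m : ℕ) (f : C(Circ, ℂ)) (j : ℤ) :
    fourierCoeff ((L ^ m) f) j = l j ^ m * fourierCoeff f j := by
  induction m with
  | zero => simp
  | succ m ih => rw [pow_succ', mul_apply_eq_comp, h, ih]; ring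

/-- Neumann expansion: if `w` has coefficients `(1 - v_j / j²) f_j` and `G m` realizes `j^{-2m}` on
the spectrum of `f`, then the norm of `f` is controlled by `w` and a remainder. -/
theorem eq_neumann_add_remainder {f w : C(Circ, ℂ)} {M : C(Circ, ℂ) →L[ℂ] C(Circ, ℂ)} {v : ℤ → ℂ}
    {G : ℕ → C(Circ, ℂ) →L[ℂ] C(Circ, ℂ)} {g : ℕ → ℤ → ℂ} (hM : HasMultiplier M v)
    (hG : ∀ m, HasMultiplier (G m) (g m))
    (hg : ∀ m j, fourierCoeff f j ≠ 0 → g m j = (((j : ℂ) ^ 2)⁻¹) ^ (m + 1))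
    (hw : ∀ j, fourierCoeff w j = (1 - v j * ((j : ℂ) ^ 2)⁻¹) * fourierCoeff f j) (N : ℕ) :
    f = w + ∑ m ∈ Finset.range N, (M ^ (m + 1)) (G m w) + (M ^ (N + 1)) (G N f) := by
  apply eq_of_fourierCoeff_eq
  intro j
  have hterm : ∀ m, fourierCoeff ((M ^ (m + 1)) (G m w)) j
      = v j ^ (m + 1) * (g m j * fourierCoeff w j) := fun m => by rw [hM.pow, hG]
  have hrem : fourierCoeff ((M ^ (N + 1)) (G N f)) j
      = v j ^ (N + 1) * (g N j * fourierCoeff f j) := by rw [hM.pow, hG]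
  have hsum : fourierCoeff (∑ m ∈ Finset.range N, (M ^ (m + 1)) (G m w) : C(Circ, ℂ)) j
      = ∑ m ∈ Finset.range N, v j ^ (m + 1) * (g m j * fourierCoeff w j) := by
    rw [ContinuousMap.coe_sum, fourierCoeff.sum _ _ (fun m _ => integrable_circ _)]
    simp only [Finset.sum_apply, hterm]
  rw [ContinuousMap.coe_add, fourierCoeff.add (integrable_circ _) (integrable_circ _),
    ContinuousMap.coe_add, Pi.add_apply,
    fourierCoeff.add (integrable_circ _) (integrable_circ _), Pi.add_apply,
    hsum, hrem, hw]
  by_cases h0 : fourierCoeff f j = 0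
  · simp [h0]
  · simp only [fun m => hg m j h0]
    -- What remains is `1 = (1 - x)(1 + x + ⋯ + x^N) + x^(N+1)`, multiplied by the coefficient of
    -- `f`.
    set x := v j * ((j : ℂ) ^ 2)⁻¹ with hx
    have h1 : ∀ m, v j ^ (m + 1) * ((((j : ℂ) ^ 2)⁻¹) ^ (m + 1) * ((1 - x) * fourierCoeff f j))
        = x * (1 - x) * fourierCoeff f j * x ^ m := fun m => by rw [hx]; ring
    have h2 : v j ^ (N + 1) * ((((j : ℂ) ^ 2)⁻¹) ^ (N + 1) * fourierCoeff f j)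
        = x ^ (N + 1) * fourierCoeff f j := by rw [hx]; ring
    simp only [h1]
    rw [h2, ← Finset.mul_sum]
    have h3 := mul_neg_geom_sum x N
    linear_combination (-x * fourierCoeff f j) * h3

/-- The partial sums of the bounds stay below `S`, so their terms tend to zero. The remainder
carries such a term as factor and disappears in the limit, so no smallness of `‖M‖ ‖G 0‖` is needed.
-/
theorem norm_le_of_neumann {f w : C(Circ, ℂ)} {M : C(Circ, ℂ) →L[ℂ] C(Circ, ℂ)} {v : ℤ → ℂ}
    {G : ℕ → C(Circ, ℂ) →L[ℂ] C(Circ, ℂ)} {g : ℕ → ℤ → ℂ} (hM : HasMultiplier M v)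
    (hG : ∀ m, HasMultiplier (G m) (g m))
    (hg : ∀ m j, fourierCoeff f j ≠ 0 → g m j = (((j : ℂ) ^ 2)⁻¹) ^ (m + 1))
    (hw : ∀ j, fourierCoeff w j = (1 - v j * ((j : ℂ) ^ 2)⁻¹) * fourierCoeff f j)
    {c S : ℝ} (hMc : ‖M‖ ≤ c ^ 2) {B : ℕ → ℝ} (hB : ∀ m, ‖G m‖ ≤ B m)
    (hS : ∀ N, ∑ m ∈ Finset.range N, c ^ (2 * (m + 1)) * B m ≤ S) :
    ‖f‖ ≤ (1 + S) * ‖w‖ := by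
  have hB0 : ∀ m, 0 ≤ c ^ (2 * (m + 1)) * B m := fun m =>
    mul_nonneg (by rw [pow_mul]; positivity) ((norm_nonneg _).trans (hB m))
  have hterm : ∀ m u, ‖(M ^ (m + 1)) (G m u)‖ ≤ c ^ (2 * (m + 1)) * B m * ‖u‖ := fun m u => by
    refine ((M ^ (m + 1)).le_opNorm _).trans ?_
    rw [mul_assoc, pow_mul]
    refine mul_le_mul ((norm_pow_le' _ m.succ_pos).trans
      (pow_le_pow_left₀ (norm_nonneg _) hMc _)) ?_ (norm_nonneg _) (by positivity)
    exact ((G m).le_opNorm u).trans (mul_le_mul_of_nonneg_right (hB m) (norm_nonneg _))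
  have hsummable := summable_of_sum_range_le hB0 hS
  have hlim : Filter.Tendsto (fun N => (1 + S) * ‖w‖ + c ^ (2 * (N + 1)) * B N * ‖f‖)
      Filter.atTop (nhds ((1 + S) * ‖w‖ + 0 * ‖f‖)) :=
    (hsummable.tendsto_atTop_zero.mul_const _).const_add _
  rw [zero_mul, add_zero] at hlim
  refine ge_of_tendsto' hlim fun N => ?_
  calc ‖f‖ = ‖w + ∑ m ∈ Finset.range N, (M ^ (m + 1)) (G m w) + (M ^ (N + 1)) (G N f)‖ := by
        rw [← eq_neumann_add_remainder hM hG hg hw N]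
    _ ≤ ‖w‖ + ∑ m ∈ Finset.range N, c ^ (2 * (m + 1)) * B m * ‖w‖
          + c ^ (2 * (N + 1)) * B N * ‖f‖ := by
        refine (norm_add_le _ _).trans (add_le_add ((norm_add_le _ _).trans
          (add_le_add le_rfl ?_)) (hterm N f))
        exact (norm_sum_le _ _).trans (Finset.sum_le_sum fun m _ => hterm m w)
    _ ≤ _ := by
        rw [← Finset.sum_mul]
        have := mul_le_mul_of_nonneg_right (hS N) (norm_nonneg w)
        linarith

open Set Filter Topology

/-! ### The secant as an integral over hyperbolic functions. -/

theorem one_sub_sigmoid_mul_exp (t : ℝ) :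
    Real.sigmoid (2 * t) * (2 * Real.cosh t) = Real.exp t ∧
      (1 - Real.sigmoid (2 * t)) * (2 * Real.cosh t) = Real.exp (-t) := by
  have h : Real.sigmoid (2 * t) * (2 * Real.cosh t) = Real.exp t := by
    have h1 : (1 + Real.exp (-(2 * t))) ≠ 0 := by positivity
    rw [Real.sigmoid_def, inv_mul_eq_div, div_eq_iff h1, Real.cosh_eq, mul_add, ← Real.exp_add]
    ring_nf
  refine ⟨h, ?_⟩
  rw [sub_mul, h, Real.cosh_eq]; ring

/-- Substituting `x = σ(2t)` in the beta integral: since `σ(2t) = e^t / (2 cosh t)` and `1 - σ(2t) =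
e^(-t) / (2 cosh t)`, the powers combine with the Jacobian to this quotient. -/
theorem beta_integrand_comp_sigmoid (ρ t : ℝ) :
    |Real.sigmoid (2 * t) * (1 - Real.sigmoid (2 * t)) * 2| •
      (((Real.sigmoid (2 * t) : ℝ) : ℂ) ^ ((((1 + ρ) / 2 : ℝ) : ℂ) - 1) *
        (1 - ((Real.sigmoid (2 * t) : ℝ) : ℂ)) ^ ((((1 - ρ) / 2 : ℝ) : ℂ) - 1))
      = ((Real.exp (ρ * t) / Real.cosh t : ℝ) : ℂ) := by
  set σ := Real.sigmoid (2 * t) with hσ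
  have h0 : 0 < σ := Real.sigmoid_pos _
  have h1 : 0 < 1 - σ := sub_pos.2 (Real.sigmoid_lt_one _)
  have hC : 0 < 2 * Real.cosh t := mul_pos two_pos (Real.cosh_pos t)
  obtain ⟨ha, hb⟩ := one_sub_sigmoid_mul_exp t
  rw [← hσ] at ha hb
  have ha' : σ = Real.exp (t - Real.log (2 * Real.cosh t)) := by
    rw [Real.exp_sub, Real.exp_log hC, eq_div_iff hC.ne', ha]
  have hb' : 1 - σ = Real.exp (-t - Real.log (2 * Real.cosh t)) := by
    rw [Real.exp_sub, Real.exp_log hC, eq_div_iff hC.ne', hb]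
  rw [show (1 : ℂ) - (σ : ℂ) = ((1 - σ : ℝ) : ℂ) by push_cast; rfl,
    show (((1 + ρ) / 2 : ℝ) : ℂ) - 1 = (((1 + ρ) / 2 - 1 : ℝ) : ℂ) by push_cast; rfl,
    show (((1 - ρ) / 2 : ℝ) : ℂ) - 1 = (((1 - ρ) / 2 - 1 : ℝ) : ℂ) by push_cast; rfl,
    ← Complex.ofReal_cpow h0.le, ← Complex.ofReal_cpow h1.le, Complex.real_smul,
    abs_of_pos (by positivity), ← Complex.ofReal_mul, ← Complex.ofReal_mul]
  congr 1
  have hlog : Real.exp (Real.log (2 * Real.cosh t)) = 2 * Real.cosh t := Real.exp_log hC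
  generalize Real.log (2 * Real.cosh t) = l at *
  rw [hb', ha', ← Real.exp_mul, ← Real.exp_mul, ← Real.exp_add, mul_right_comm, ← Real.exp_add,
    ← Real.exp_add, show Real.cosh t = Real.exp l / 2 by rw [hlog]; ring,
    div_div_eq_mul_div, eq_div_iff (Real.exp_pos _).ne', mul_right_comm, ← Real.exp_add]
  ring_nf

/-- The integral is the beta function at `(1 ± ρ)/2`; as these arguments sum to `1`, Euler's
reflection formula evaluates it as `π / sin(π(1 + ρ)/2)`. -/
theorem integral_exp_div_cosh {ρ : ℝ} (hρ : |ρ| < 1) :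
    Integrable (fun t : ℝ => Real.exp (ρ * t) / Real.cosh t) ∧
      ∫ t : ℝ, Real.exp (ρ * t) / Real.cosh t = Real.pi * (Real.cos (Real.pi / 2 * ρ))⁻¹ := by
  obtain ⟨hρ1, hρ2⟩ := abs_lt.1 hρ
  set g : ℝ → ℂ := fun x => (x : ℂ) ^ ((((1 + ρ) / 2 : ℝ) : ℂ) - 1) *
        (1 - (x : ℂ)) ^ ((((1 - ρ) / 2 : ℝ) : ℂ) - 1) with hg
  have himg : (fun t : ℝ => Real.sigmoid (2 * t)) '' univ = Ioo 0 1 := by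
    rw [← Real.range_sigmoid, image_univ]
    exact (mul_left_surjective₀ (two_ne_zero' ℝ)).range_comp Real.sigmoid
  have hderiv : ∀ t ∈ (univ : Set ℝ), HasDerivWithinAt (fun t : ℝ => Real.sigmoid (2 * t))
      (Real.sigmoid (2 * t) * (1 - Real.sigmoid (2 * t)) * 2) univ t := fun t _ => by
    have := (Real.hasDerivAt_sigmoid (2 * t)).comp t ((hasDerivAt_id t).const_mul 2)
    simp only [mul_one] at this
    exact this.hasDerivWithinAt
  have hinj : InjOn (fun t : ℝ => Real.sigmoid (2 * t)) univ := fun a _ b _ hab =>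
    mul_left_cancel₀ two_ne_zero (Real.sigmoid_injective hab)
  have hu : 0 < ((((1 + ρ) / 2 : ℝ)) : ℂ).re := by rw [Complex.ofReal_re]; linarith
  have hv : 0 < ((((1 - ρ) / 2 : ℝ)) : ℂ).re := by rw [Complex.ofReal_re]; linarith
  have hgi : IntegrableOn g (Ioo 0 1) := by
    rw [← integrableOn_Ioc_iff_integrableOn_Ioo,
      ← intervalIntegrable_iff_integrableOn_Ioc_of_le zero_le_one]
    exact Complex.betaIntegral_convergent hu hv
  have hval : ∫ x in Ioo 0 1, g x = ((Real.pi * (Real.cos (Real.pi / 2 * ρ))⁻¹ : ℝ) : ℂ) := by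
    rw [← integral_Ioc_eq_integral_Ioo, ← intervalIntegral.integral_of_le zero_le_one]
    have h1 := Complex.betaIntegral_eq_Gamma_mul_div _ _ hu hv
    have h2 : (((1 - ρ) / 2 : ℝ) : ℂ) = 1 - (((1 + ρ) / 2 : ℝ) : ℂ) := by push_cast; ring
    rw [Complex.betaIntegral] at h1
    rw [h1, h2, Complex.Gamma_mul_Gamma_one_sub, add_sub_cancel, Complex.Gamma_one, div_one,
      ← Complex.ofReal_mul, ← Complex.ofReal_sin, ← Complex.ofReal_div]
    congr 1
    rw [div_eq_mul_inv, show Real.pi * ((1 + ρ) / 2) = Real.pi / 2 * ρ + Real.pi / 2 by ring,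
      Real.sin_add_pi_div_two]
  have hI := integrableOn_image_iff_integrableOn_abs_deriv_smul MeasurableSet.univ hderiv hinj g
  have hE := integral_image_eq_integral_abs_deriv_smul MeasurableSet.univ hderiv hinj g
  rw [himg] at hI hE
  simp only [hg, beta_integrand_comp_sigmoid, integrableOn_univ, Measure.restrict_univ] at hI hE
  refine ⟨?_, ?_⟩
  · have h := (hI.1 hgi).re
    simp only [RCLike.re_eq_complex_re, Complex.ofReal_re] at h
    exact h
  · rw [integral_complex_ofReal] at hE
    exact_mod_cast hE.symm.trans hval

theorem integral_cosh_div_cosh {ρ : ℝ} (hρ : |ρ| < 1) :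
    IntegrableOn (fun t : ℝ => Real.cosh (ρ * t) / Real.cosh t) (Ioi 0) ∧
      ∫ t in Ioi (0 : ℝ), Real.cosh (ρ * t) / Real.cosh t
        = Real.pi / 2 * (Real.cos (Real.pi / 2 * ρ))⁻¹ := by
  obtain ⟨i1, e1⟩ := integral_exp_div_cosh hρ
  obtain ⟨i2, e2⟩ := integral_exp_div_cosh (ρ := -ρ) (by rwa [abs_neg])
  have hfun : (fun t : ℝ => Real.cosh (ρ * t) / Real.cosh t) = fun t =>
      (1 / 2 : ℝ) * (Real.exp (ρ * t) / Real.cosh t + Real.exp (-ρ * t) / Real.cosh t) := by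
    funext t
    rw [Real.cosh_eq (ρ * t)]; ring_nf
  have hi : Integrable (fun t : ℝ => Real.cosh (ρ * t) / Real.cosh t) := by
    rw [hfun]; exact (i1.add i2).const_mul _
  refine ⟨hi.integrableOn, ?_⟩
  have h1 := integral_comp_abs (f := fun t : ℝ => Real.cosh (ρ * t) / Real.cosh t)
  have h2 : (fun t : ℝ => Real.cosh (ρ * |t|) / Real.cosh |t|)
      = fun t => Real.cosh (ρ * t) / Real.cosh t := by
    funext t
    rw [Real.cosh_abs, ← Real.cosh_abs, abs_mul, abs_abs, ← abs_mul, Real.cosh_abs]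
  have h3 : ∫ t : ℝ, Real.cosh (ρ * t) / Real.cosh t
      = Real.pi * (Real.cos (Real.pi / 2 * ρ))⁻¹ := by
    rw [hfun, integral_const_mul, integral_add i1 i2, e1, e2, mul_neg, Real.cos_neg]; ring
  rw [h2, h3] at h1
  linarith

/-! ### The function `κ` and the generating function of its moments. -/

/-- `κ(t) = 1 - (2/π) arctan (sinh t)`, the `L¹` norm of the best approximation error of the
Poisson kernel. -/
noncomputable def kappa (t : ℝ) : ℝ := 1 - 2 / Real.pi * Real.arctan (Real.sinh t)

theorem continuous_kappa : Continuous kappa :=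
  continuous_const.sub (continuous_const.mul (Real.continuous_arctan.comp Real.continuous_sinh))

theorem kappa_nonneg (t : ℝ) : 0 ≤ kappa t := by
  have h := (Real.arctan_lt_pi_div_two (Real.sinh t)).le
  have : 2 / Real.pi * Real.arctan (Real.sinh t) ≤ 2 / Real.pi * (Real.pi / 2) :=
    mul_le_mul_of_nonneg_left h (by positivity)
  rw [div_mul_div_comm, mul_comm 2, div_self (by positivity)] at this
  unfold kappa; linarith

theorem kappa_eq_arctan_inv {t : ℝ} (ht : 0 < t) :
    kappa t = 2 / Real.pi * Real.arctan (Real.sinh t)⁻¹ := by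
  rw [Real.arctan_inv_of_pos (Real.sinh_pos_iff.2 ht), kappa]
  field_simp

theorem kappa_le_exp {t : ℝ} (ht : 1 ≤ t) : kappa t ≤ 8 * Real.exp (-t) := by
  have h1 : (1 : ℝ) + 1 ≤ Real.exp t := by linarith [Real.add_one_le_exp t]
  have h2 : Real.exp t / 4 ≤ Real.sinh t := by
    have h3 : Real.exp (-t) ≤ 1 := Real.exp_le_one_iff.2 (by linarith)
    rw [Real.sinh_eq]; linarith
  have h4 : 0 < Real.exp t := Real.exp_pos t
  have h5 : (Real.sinh t)⁻¹ ≤ 4 * Real.exp (-t) := by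
    rw [Real.exp_neg, ← div_eq_mul_inv, ← inv_div]
    exact inv_anti₀ (by positivity) h2
  rw [kappa_eq_arctan_inv (by linarith)]
  have h7 : 2 / Real.pi ≤ 2 := div_le_self zero_le_two (by linarith [Real.pi_gt_three])
  have h8 : 0 ≤ Real.arctan (Real.sinh t)⁻¹ := Real.arctan_nonneg.2 (inv_nonneg.2 (by linarith))
  have h6 : Real.arctan (Real.sinh t)⁻¹ ≤ (Real.sinh t)⁻¹ := by
    simpa only [Real.tan_arctan] using Real.le_tan h8 (Real.arctan_lt_pi_div_two _)
  nlinarith [mul_le_mul_of_nonneg_right h7 h8]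

theorem hasDerivAt_kappa (t : ℝ) : HasDerivAt kappa (-(2 / Real.pi) / Real.cosh t) t := by
  have h := (((Real.hasDerivAt_sinh t).arctan).const_mul (2 / Real.pi)).const_sub 1
  have hc := Real.cosh_pos t
  refine h.congr_deriv ?_
  rw [add_comm, ← Real.cosh_sq]
  field_simp

/-- Integration by parts with `κ' = -(2/π)/cosh` leaves integrals of `cosh(ρt)/cosh t` and `1/cosh
t`. The boundary term at infinity vanishes because `κ` decays like `e^(-t)` and `ρ < 1`. -/
theorem integral_sinh_mul_kappa {ρ : ℝ} (h0 : 0 ≤ ρ) (h1 : ρ < 1) :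
    IntegrableOn (fun t => ρ * Real.sinh (ρ * t) * kappa t) (Ioi 0) ∧
      ∫ t in Ioi (0 : ℝ), ρ * Real.sinh (ρ * t) * kappa t
        = (Real.cos (Real.pi / 2 * ρ))⁻¹ - 1 := by
  obtain ⟨i1, e1⟩ := integral_cosh_div_cosh (ρ := ρ) (by rwa [abs_of_nonneg h0])
  obtain ⟨i2, e2⟩ := integral_cosh_div_cosh (ρ := 0) (by simp)
  set g : ℝ → ℝ := fun t => 2 / Real.pi *
    (Real.cosh (ρ * t) / Real.cosh t - Real.cosh (0 * t) / Real.cosh t) with hg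
  have hgc : Continuous g := by
    have : ∀ t, Real.cosh t ≠ 0 := fun t => (Real.cosh_pos t).ne'
    exact continuous_const.mul (((Real.continuous_cosh.comp (by fun_prop)).div
      Real.continuous_cosh this).sub ((Real.continuous_cosh.comp (by fun_prop)).div
      Real.continuous_cosh this))
  have hgi : IntegrableOn g (Ioi 0) := (i1.sub i2).const_mul _
  have hge : ∫ t in Ioi 0, g t = (Real.cos (Real.pi / 2 * ρ))⁻¹ - 1 := by
    rw [hg, integral_const_mul, integral_sub i1 i2, e1, e2]
    simp only [mul_zero, Real.cos_zero]
    field_simp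
  -- Taking `cosh(ρt) - 1` as the antiderivative of `ρ sinh(ρt)` makes the antiderivative `Ψ` vanish
  -- at `0`.
  set Ψ : ℝ → ℝ := fun t => (Real.cosh (ρ * t) - 1) * kappa t + ∫ s in (0 : ℝ)..t, g s with hΨ
  have hd : ∀ t ∈ Ici (0 : ℝ), HasDerivAt Ψ (ρ * Real.sinh (ρ * t) * kappa t) t := fun t _ => by
    have ha : HasDerivAt (fun t => Real.cosh (ρ * t) - 1) (Real.sinh (ρ * t) * ρ) t := by
      have := (((hasDerivAt_id t).const_mul ρ).cosh).sub_const 1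
      simpa using! this
    have hb := hgc.integral_hasStrictDerivAt 0 t
    refine ((ha.mul (hasDerivAt_kappa t)).add hb.hasDerivAt).congr_deriv ?_
    simp only [hg, zero_mul, Real.cosh_zero]
    ring
  have hpos : ∀ t ∈ Ioi (0 : ℝ), 0 ≤ ρ * Real.sinh (ρ * t) * kappa t := fun t ht =>
    mul_nonneg (mul_nonneg h0 (Real.sinh_nonneg_iff.2 (mul_nonneg h0 (le_of_lt ht))))
      (kappa_nonneg t)
  have hbd : Tendsto (fun t => (Real.cosh (ρ * t) - 1) * kappa t) atTop (𝓝 0) := by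
    have hexp : Tendsto (fun t : ℝ => 8 * Real.exp (-((1 - ρ) * t))) atTop (𝓝 (8 * 0)) :=
      (Real.tendsto_exp_neg_atTop_nhds_zero.comp
        (tendsto_id.const_mul_atTop (sub_pos.2 h1))).const_mul 8
    rw [mul_zero] at hexp
    refine squeeze_zero' (Eventually.of_forall fun t =>
      mul_nonneg (sub_nonneg.2 (Real.one_le_cosh _)) (kappa_nonneg t)) ?_ hexp
    filter_upwards [eventually_ge_atTop 1] with t ht
    have hρt : 0 ≤ ρ * t := mul_nonneg h0 (by linarith)
    have hc : Real.cosh (ρ * t) - 1 ≤ Real.exp (ρ * t) := by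
      have : Real.exp (-(ρ * t)) ≤ Real.exp (ρ * t) := Real.exp_le_exp.2 (by linarith)
      rw [Real.cosh_eq]; linarith
    calc (Real.cosh (ρ * t) - 1) * kappa t ≤ Real.exp (ρ * t) * (8 * Real.exp (-t)) :=
          mul_le_mul hc (kappa_le_exp ht) (kappa_nonneg t) (Real.exp_pos _).le
      _ = 8 * Real.exp (-((1 - ρ) * t)) := by
          rw [mul_left_comm, ← Real.exp_add]; ring_nf
  have hlim : Tendsto Ψ atTop (𝓝 (0 + ∫ t in Ioi 0, g t)) :=
    hbd.add (intervalIntegral_tendsto_integral_Ioi 0 hgi tendsto_id)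
  refine ⟨integrableOn_Ioi_deriv_of_nonneg' hd hpos hlim, ?_⟩
  rw [integral_Ioi_of_hasDerivAt_of_nonneg' hd hpos hlim, hge]
  simp [hΨ]

theorem sum_pow_le_sinh {x : ℝ} (hx : 0 ≤ x) (N : ℕ) :
    ∑ m ∈ Finset.range N, x ^ (2 * m + 1) / ((2 * m + 1).factorial : ℝ) ≤ Real.sinh x :=
  sum_le_hasSum _ (fun m _ => by positivity) (Real.hasSum_sinh x)

theorem integrableOn_sinh_mul_kappa_comp {c ν : ℝ} (h0 : 0 ≤ c) (h1 : c < ν) :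
    IntegrableOn (fun t => c * Real.sinh (c * t) * kappa (ν * t)) (Ioi 0) ∧
      ∫ t in Ioi (0 : ℝ), c * Real.sinh (c * t) * kappa (ν * t)
        = (Real.cos (Real.pi / 2 * (c / ν)))⁻¹ - 1 := by
  have hν : 0 < ν := h0.trans_lt h1
  obtain ⟨hi, he⟩ := integral_sinh_mul_kappa (ρ := c / ν) (by positivity) ((div_lt_one hν).2 h1)
  have hfun : (fun t => c * Real.sinh (c * t) * kappa (ν * t)) = fun t =>
      ν * ((fun s => c / ν * Real.sinh (c / ν * s) * kappa s) (ν * t)) := by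
    funext t
    have : c / ν * (ν * t) = c * t := by field_simp
    simp only [this]
    field_simp
  rw [hfun]
  refine ⟨Integrable.const_mul ?_ _, ?_⟩
  · have := (integrableOn_Ioi_comp_mul_left_iff
      (fun s => c / ν * Real.sinh (c / ν * s) * kappa s) 0 hν).2
    rw [mul_zero] at this
    exact this hi
  · rw [integral_const_mul, integral_comp_mul_left_Ioi
      (fun s => c / ν * Real.sinh (c / ν * s) * kappa s) _ hν, mul_zero, he, smul_eq_mul]
    field_simp

theorem integrableOn_pow_mul_kappa {ν : ℝ} (hν : 0 < ν) (m : ℕ) :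
    IntegrableOn (fun t : ℝ => t ^ (2 * m + 1) / ((2 * m + 1).factorial : ℝ) * kappa (ν * t))
      (Ioi 0) := by
  -- Any constant in `(0, ν)` would do: a single term of the `sinh` series is dominated by the whole
  -- series.
  have hc : 0 < ν / 2 := by positivity
  have h := (integrableOn_sinh_mul_kappa_comp hc.le (half_lt_self hν)).1
  have h2 := h.const_mul (((ν / 2) ^ (2 * m + 2))⁻¹)
  refine Integrable.mono' h2 ?_ ?_
  · exact (Continuous.mul (by fun_prop) (continuous_kappa.comp (by fun_prop))).aestronglyMeasurable
  · refine (ae_restrict_iff' measurableSet_Ioi).2 (Eventually.of_forall fun t ht => ?_)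
    have ht0 : 0 < t := ht
    have h3 := le_hasSum (Real.hasSum_sinh (ν / 2 * t)) m (fun i _ => by positivity)
    rw [Real.norm_of_nonneg (mul_nonneg (by positivity) (kappa_nonneg _)), ← mul_assoc]
    refine mul_le_mul_of_nonneg_right ?_ (kappa_nonneg _)
    rw [inv_mul_eq_div, le_div_iff₀ (by positivity)]
    calc t ^ (2 * m + 1) / ((2 * m + 1).factorial : ℝ) * (ν / 2) ^ (2 * m + 2)
        = ν / 2 * ((ν / 2 * t) ^ (2 * m + 1) / ((2 * m + 1).factorial : ℝ)) := by
          rw [mul_pow]; ring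
      _ ≤ _ := mul_le_mul_of_nonneg_left h3 hc.le

/-- The generating function of the moments of `κ` is dominated by a secant. -/
theorem sum_moment_kappa_le {c ν : ℝ} (h0 : 0 ≤ c) (h1 : c < ν) (N : ℕ) :
    ∑ m ∈ Finset.range N, c ^ (2 * (m + 1)) *
      ∫ t in Ioi (0 : ℝ), t ^ (2 * m + 1) / ((2 * m + 1).factorial : ℝ) * kappa (ν * t)
      ≤ (Real.cos (Real.pi / 2 * (c / ν)))⁻¹ - 1 := by
  have hν : 0 < ν := h0.trans_lt h1
  obtain ⟨hi, he⟩ := integrableOn_sinh_mul_kappa_comp h0 h1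
  rw [← he]
  simp only [← integral_const_mul]
  rw [← integral_finsetSum _ fun m _ => (integrableOn_pow_mul_kappa hν m).const_mul _]
  refine setIntegral_mono_on
    (integrable_finsetSum _ fun m _ => (integrableOn_pow_mul_kappa hν m).const_mul _) hi
    measurableSet_Ioi fun t ht => ?_
  have ht0 : 0 < t := ht
  calc ∑ m ∈ Finset.range N, c ^ (2 * (m + 1)) *
        (t ^ (2 * m + 1) / ((2 * m + 1).factorial : ℝ) * kappa (ν * t))
      = c * (∑ m ∈ Finset.range N, (c * t) ^ (2 * m + 1) / ((2 * m + 1).factorial : ℝ))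
          * kappa (ν * t) := by
        rw [Finset.mul_sum, Finset.sum_mul]
        exact Finset.sum_congr rfl fun m _ => by rw [mul_pow]; ring
    _ ≤ _ := by
        refine mul_le_mul_of_nonneg_right (mul_le_mul_of_nonneg_left ?_ h0) (kappa_nonneg _)
        exact sum_pow_le_sinh (by positivity) N

/-! ### The Poisson kernel of the circle. -/

theorem fourier_re_le_one (j : ℤ) (x : Circ) : (fourier j x).re ≤ 1 :=
  (Complex.re_le_norm _).trans (norm_fourier_apply j x).le

theorem integral_fourier_mul_fourier (l j : ℤ) :
    ∫ x : Circ, fourier l x * fourier j x ∂haarAddCircle = if l = -j then 1 else 0 := by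
  have h := congrFun (fourierCoeff_fourier (T := 2 * Real.pi) l) (-j)
  rw [fourierCoeff, neg_neg] at h
  simp only [smul_eq_mul, Pi.single_apply] at h
  rw [← if_congr eq_comm rfl rfl, ← h]
  exact integral_congr_ae (Eventually.of_forall fun x => mul_comm _ _)

/-- The Poisson kernel `sinh t / (cosh t - cos x)` of the circle. -/
noncomputable def poisson (t : ℝ) (x : Circ) : ℝ :=
  Real.sinh t / (Real.cosh t - (fourier 1 x).re)

theorem cosh_sub_pos {t : ℝ} (ht : 0 < t) (x : Circ) : 0 < Real.cosh t - (fourier 1 x).re := by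
  have := Real.one_lt_cosh.2 ht.ne'
  linarith [fourier_re_le_one 1 x]

theorem poisson_pos {t : ℝ} (ht : 0 < t) (x : Circ) : 0 < poisson t x :=
  div_pos (Real.sinh_pos_iff.2 ht) (cosh_sub_pos ht x)

theorem continuous_poisson {t : ℝ} (ht : 0 < t) : Continuous (poisson t) :=
  continuous_const.div (continuous_const.sub (Complex.continuous_re.comp (map_continuous _)))
    fun x => (cosh_sub_pos ht x).ne'

theorem fourier_natCast_eq_pow (l : ℕ) (x : Circ) : fourier (l : ℤ) x = fourier 1 x ^ l := by
  induction l with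
  | zero => simp
  | succ l ih => rw [Nat.cast_succ, fourier_add, ih, pow_succ]

/-- With `z = e^(ix)`, the nonnegative and negative frequencies form geometric series in `e^(-t) z`
and `e^(-t) z̄`. -/
theorem hasSum_poisson {t : ℝ} (ht : 0 < t) (x : Circ) :
    HasSum (fun l : ℤ => ((Real.exp (-(t * |(l : ℝ)|)) : ℝ) : ℂ) * fourier l x)
      (poisson t x : ℂ) := by
  set z : ℂ := fourier 1 x with hz
  have hz1 : ‖z‖ = 1 := norm_fourier_apply 1 x
  set w : ℂ := (starRingEnd ℂ) z with hw
  have hw1 : ‖w‖ = 1 := by rw [hw, Complex.norm_conj, hz1]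
  have hzw : z * w = 1 := by rw [hw, Complex.mul_conj, Complex.normSq_eq_norm_sq, hz1]; norm_num
  have hsum : z + w = 2 * (z.re : ℂ) := by rw [hw, Complex.add_conj]; push_cast; rfl
  set e : ℝ := Real.exp (-t) with he
  have he0 : 0 < e := Real.exp_pos _
  have he1 : e < 1 := Real.exp_lt_one_iff.2 (by linarith)
  have hlt : ∀ u : ℂ, ‖u‖ = 1 → ‖(e : ℂ) * u‖ < 1 := fun u hu => by
    rw [norm_mul, hu, mul_one, Complex.norm_real, Real.norm_of_nonneg he0.le]; exact he1
  have hexp : ∀ l : ℕ, Real.exp (-(t * (l : ℝ))) = e ^ l := fun l => by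
    rw [he, ← Real.exp_nat_mul]; ring_nf
  have h1 := hasSum_geometric_of_norm_lt_one (hlt z hz1)
  have h2 := (hasSum_geometric_of_norm_lt_one (hlt w hw1)).mul_left ((e : ℂ) * w)
  have hne : ∀ u : ℂ, ‖u‖ = 1 → 1 - (e : ℂ) * u ≠ 0 := fun u hu h => by
    have := hlt u hu
    rw [← sub_eq_zero.1 h, norm_one] at this
    exact lt_irrefl _ this
  have hval : (1 - (e : ℂ) * z)⁻¹ + (e : ℂ) * w * (1 - (e : ℂ) * w)⁻¹ = (poisson t x : ℂ) := by
    have hd : ((Real.cosh t - z.re : ℝ) : ℂ) ≠ 0 :=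
      Complex.ofReal_ne_zero.2 (cosh_sub_pos ht x).ne'
    have hexpt : Real.exp t = e⁻¹ := by rw [he, Real.exp_neg, inv_inv]
    rw [poisson, Complex.ofReal_div, eq_div_iff hd]
    have ec : (e : ℂ) ≠ 0 := Complex.ofReal_ne_zero.2 he0.ne'
    have hcosh : ((Real.cosh t - z.re : ℝ) : ℂ) = ((e : ℂ)⁻¹ + e - (z + w)) / 2 := by
      rw [hsum, Real.cosh_eq, hexpt, ← he]; push_cast; ring
    have hsinh : ((Real.sinh t : ℝ) : ℂ) = ((e : ℂ)⁻¹ - e) / 2 := by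
      rw [Real.sinh_eq, hexpt, ← he]; push_cast; ring
    rw [hcosh, hsinh]
    have a1 := hne z hz1
    have a2 := hne w hw1
    have hprod : ((e : ℂ)⁻¹ + e - (z + w)) = (e : ℂ)⁻¹ * ((1 - e * z) * (1 - e * w)) := by
      field_simp
      linear_combination (-(e : ℂ) ^ 2) * hzw
    rw [hprod]
    calc _ = (e : ℂ)⁻¹ / 2 * ((1 - e * z)⁻¹ * (1 - e * z) * (1 - e * w)
          + e * w * (1 - e * z) * ((1 - e * w)⁻¹ * (1 - e * w))) := by ring
      _ = (e : ℂ)⁻¹ / 2 * (1 - e ^ 2) := by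
          rw [inv_mul_cancel₀ a1, inv_mul_cancel₀ a2]
          linear_combination (-(e : ℂ)⁻¹ / 2 * e ^ 2) * hzw
      _ = _ := by field_simp
  rw [← hval]
  refine HasSum.of_nat_of_neg_add_one ?_ ?_
  · have e1 : ∀ l : ℕ, ((Real.exp (-(t * |(((l : ℤ)) : ℝ)|)) : ℝ) : ℂ) * fourier (l : ℤ) x
        = ((e : ℂ) * z) ^ l := fun l => by
      rw [fourier_natCast_eq_pow, Int.cast_natCast, abs_of_nonneg (Nat.cast_nonneg _), hexp,
        mul_pow, Complex.ofReal_pow]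
    simp only [e1]
    exact h1
  · have e2 : ∀ l : ℕ, ((Real.exp (-(t * |((-((l : ℤ) + 1) : ℤ) : ℝ)|)) : ℝ) : ℂ)
        * fourier (-((l : ℤ) + 1)) x = (e : ℂ) * w * ((e : ℂ) * w) ^ l := fun l => by
      rw [show -((l : ℤ) + 1) = -((l + 1 : ℕ) : ℤ) by push_cast; ring, fourier_neg,
        fourier_natCast_eq_pow, Int.cast_neg, abs_neg, Int.cast_natCast,
        abs_of_nonneg (Nat.cast_nonneg _), hexp, map_pow, ← hz, ← hw, Complex.ofReal_pow]
      ring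
    simp only [e2]
    exact h2

theorem summable_exp_neg_mul_abs {t : ℝ} (ht : 0 < t) :
    Summable fun l : ℤ => Real.exp (-(t * |(l : ℝ)|)) := by
  have h := (hasSum_poisson ht 0).summable
  simp only [fourier_eval_zero, mul_one] at h
  exact_mod_cast h

theorem integrable_ofReal_poisson_mul {t : ℝ} (ht : 0 < t) (g : C(Circ, ℂ)) :
    Integrable (fun x => (poisson t x : ℂ) * g x) haarAddCircle :=
  integrable_circ ⟨fun x => (poisson t x : ℂ) * g x,
    (Complex.continuous_ofReal.comp (continuous_poisson ht)).mul g.continuous⟩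

theorem integral_poisson_mul_fourier {t : ℝ} (ht : 0 < t) (j : ℤ) :
    ∫ x, (poisson t x : ℂ) * fourier j x ∂haarAddCircle
      = ((Real.exp (-(t * |(j : ℝ)|)) : ℝ) : ℂ) := by
  set F : ℤ → Circ → ℂ := fun l x =>
    ((Real.exp (-(t * |(l : ℝ)|)) : ℝ) : ℂ) * fourier l x * fourier j x with hF
  have hnorm : ∀ l x, ‖F l x‖ = Real.exp (-(t * |(l : ℝ)|)) := fun l x => by
    rw [hF]
    simp only [norm_mul, norm_fourier_apply, mul_one, Complex.norm_real]
    exact Real.norm_of_nonneg (Real.exp_pos _).le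
  have hi : ∀ l, Integrable (F l) haarAddCircle := fun l =>
    integrable_circ ⟨F l, by
      exact (continuous_const.mul (map_continuous _)).mul (map_continuous _)⟩
  have h := hasSum_integral_of_summable_integral_norm hi (by
    simp only [hnorm, integral_const, probReal_univ, one_smul]
    exact summable_exp_neg_mul_abs ht)
  have h1 : ∀ x, ∑' l, F l x = (poisson t x : ℂ) * fourier j x := fun x =>
    ((hasSum_poisson ht x).mul_right _).tsum_eq
  have h2 : ∀ l, ∫ x, F l x ∂haarAddCircle
      = if l = -j then ((Real.exp (-(t * |(j : ℝ)|)) : ℝ) : ℂ) else 0 := fun l => by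
    simp only [hF, mul_assoc]
    rw [integral_const_mul, integral_fourier_mul_fourier]
    split_ifs with hl
    · rw [hl, Int.cast_neg, abs_neg, mul_one]
    · rw [mul_zero]
  simp only [h1, h2] at h
  exact h.unique (hasSum_ite_eq _ _)

theorem fourier_eq_fourier_one_nsmul (n : ℕ) (j : ℤ) (x : Circ) :
    fourier j (n • x) = fourier (j * n) x := by
  rw [fourier_apply, fourier_apply, ← natCast_zsmul, ← mul_zsmul]

/-- Averaging `g (n x)` against the Poisson kernel amounts to rescaling the kernel. -/
theorem integral_poisson_mul_comp_nsmul {t : ℝ} (ht : 0 < t) {n : ℕ} (hn : 1 ≤ n)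
    (g : C(Circ, ℂ)) :
    ∫ x, (poisson t x : ℂ) * g (n • x) ∂haarAddCircle
      = ∫ x, (poisson (n * t) x : ℂ) * g x ∂haarAddCircle := by
  have hnt : 0 < (n : ℝ) * t := mul_pos (by exact_mod_cast hn) ht
  have hq : ∀ {s : ℝ}, 0 < s → Integrable (fun x => (poisson s x : ℂ)) haarAddCircle := fun hs =>
    integrable_circ ⟨_, Complex.continuous_ofReal.comp (continuous_poisson hs)⟩
  have hs : Measurable fun x : Circ => n • x := (continuous_nsmul n).measurable
  -- Both averages have the same multiplier, since frequency `j` evaluated at `n x` is frequency `j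
  -- n`. The claim is then their equality at the point `0`.
  have hL : shiftAverage (hq ht) hs g = shiftAverage (hq hnt) measurable_id g := by
    refine eq_of_fourierCoeff_eq fun j => ?_
    rw [fourierCoeff_shiftAverage, fourierCoeff_shiftAverage]
    congr 1
    simp only [fourier_eq_fourier_one_nsmul, id_eq]
    rw [integral_poisson_mul_fourier ht, integral_poisson_mul_fourier hnt]
    rw [Int.cast_mul, Int.cast_natCast, abs_mul, abs_of_nonneg (Nat.cast_nonneg n : (0 : ℝ) ≤ n),
      mul_comm |(j : ℝ)|, ← mul_assoc, mul_comm t]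
  have h0 := congrArg (fun u : C(Circ, ℂ) => u 0) hL
  simpa only [shiftAverage_apply, zero_add, id_eq] using h0

theorem fourier_one_coe_re (x : ℝ) : (fourier 1 (x : Circ)).re = Real.cos x := by
  rw [fourier_coe_apply]
  have h : 2 * (Real.pi : ℂ) * Complex.I * ((1 : ℤ) : ℂ) * x / ((2 * Real.pi : ℝ) : ℂ)
      = x * Complex.I := by
    have : (Real.pi : ℂ) ≠ 0 := Complex.ofReal_ne_zero.2 Real.pi_ne_zero
    push_cast
    field_simp
  rw [h, Complex.exp_ofReal_mul_I_re]

/-! ### The `L¹` norm and the coefficients of the interpolation error. -/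

/-- The two fractions add up to a multiple of `cos x / (sinh² s + sin² x)`, because `cosh² s - cos²
x = sinh² s + sin² x`; this is an arctangent derivative in `sin x`. -/
theorem integral_cos_div_add_cos_div {s : ℝ} (hs : 0 < s) :
    ∫ x in (-(Real.pi / 2))..(Real.pi / 2),
      (Real.cos x * (Real.sinh s / (Real.cosh s - Real.cos x))
        + Real.cos x * (Real.sinh s / (Real.cosh s + Real.cos x)))
      = 4 * Real.cosh s * Real.arctan (Real.sinh s)⁻¹ := by
  have hsh : 0 < Real.sinh s := Real.sinh_pos_iff.2 hs
  have hc : 1 < Real.cosh s := Real.one_lt_cosh.2 hs.ne'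
  have hd1 : ∀ x, Real.cosh s - Real.cos x ≠ 0 := fun x => by
    have := Real.cos_le_one x; exact (by linarith : 0 < Real.cosh s - Real.cos x).ne'
  have hd2 : ∀ x, Real.cosh s + Real.cos x ≠ 0 := fun x => by
    have := Real.neg_one_le_cos x; exact (by linarith : 0 < Real.cosh s + Real.cos x).ne'
  have hderiv : ∀ x ∈ uIcc (-(Real.pi / 2)) (Real.pi / 2),
      HasDerivAt (fun x => 2 * Real.cosh s * Real.arctan (Real.sin x / Real.sinh s))
        (Real.cos x * (Real.sinh s / (Real.cosh s - Real.cos x))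
        + Real.cos x * (Real.sinh s / (Real.cosh s + Real.cos x))) x := fun x _ => by
    refine ((((Real.hasDerivAt_sin x).div_const _).arctan).const_mul (2 * Real.cosh s)).congr_deriv ?_
    have e1 : 1 + (Real.sin x / Real.sinh s) ^ 2
        = (Real.cosh s - Real.cos x) * (Real.cosh s + Real.cos x) / Real.sinh s ^ 2 := by
      have h1 := Real.sin_sq_add_cos_sq x
      have h2 := Real.cosh_sq s
      field_simp
      linear_combination h1 - h2
    have := hd1 x
    have := hd2 x
    rw [e1]
    field_simp
    ring
  rw [intervalIntegral.integral_eq_sub_of_hasDerivAt hderiv]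
  · rw [Real.sin_neg, Real.sin_pi_div_two, neg_div, Real.arctan_neg, one_div]; ring
  · refine Continuous.intervalIntegrable ?_ _ _
    exact (Real.continuous_cos.mul (continuous_const.div (by fun_prop) hd1)).add
      (Real.continuous_cos.mul (continuous_const.div (by fun_prop) hd2))

theorem integral_poisson_mul_abs_cos {s : ℝ} (hs : 0 < s) :
    ∫ x, poisson s x * |(fourier 1 x).re| ∂haarAddCircle = Real.cosh s * kappa s := by
  have hcont : Continuous fun x : Circ => poisson s x * |(fourier 1 x).re| :=
    (continuous_poisson hs).mul (Complex.continuous_re.comp (map_continuous _)).abs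
  have hcont' : Continuous fun x : ℝ => poisson s (x : Circ) * |(fourier 1 (x : Circ)).re| :=
    hcont.comp (AddCircle.continuous_mk' _)
  -- A period starting at `-π/2` splits into two halves on which `cos` has constant sign; shifting
  -- the second by `π` folds it onto the first.
  rw [integral_haarAddCircle, ← AddCircle.intervalIntegral_preimage _ (-(Real.pi / 2)),
    ← intervalIntegral.integral_add_adjacent_intervals (b := Real.pi / 2)
      (hcont'.intervalIntegrable _ _) (hcont'.intervalIntegrable _ _)]
  have hsecond : ∫ x in (Real.pi / 2)..(-(Real.pi / 2) + 2 * Real.pi),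
      poisson s (x : Circ) * |(fourier 1 (x : Circ)).re|
      = ∫ x in (-(Real.pi / 2))..(Real.pi / 2),
        poisson s ((x + Real.pi : ℝ) : Circ) * |(fourier 1 ((x + Real.pi : ℝ) : Circ)).re| := by
    rw [intervalIntegral.integral_comp_add_right
      (fun x : ℝ => poisson s (x : Circ) * |(fourier 1 (x : Circ)).re|)]
    congr 1 <;> ring
  have hcont2 : Continuous fun x : ℝ =>
      poisson s ((x + Real.pi : ℝ) : Circ) * |(fourier 1 ((x + Real.pi : ℝ) : Circ)).re| :=
    hcont'.comp (continuous_add_const Real.pi)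
  rw [hsecond, ← intervalIntegral.integral_add (hcont'.intervalIntegrable _ _)
    (hcont2.intervalIntegrable _ _)]
  have hcongr : ∫ x in (-(Real.pi / 2))..(Real.pi / 2),
      (poisson s (x : Circ) * |(fourier 1 (x : Circ)).re|
        + poisson s ((x + Real.pi : ℝ) : Circ) * |(fourier 1 ((x + Real.pi : ℝ) : Circ)).re|)
      = 4 * Real.cosh s * Real.arctan (Real.sinh s)⁻¹ := by
    rw [← integral_cos_div_add_cos_div hs]
    refine intervalIntegral.integral_congr fun x hx => ?_
    rw [uIcc_of_le (by linarith [Real.pi_pos])] at hx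
    have hx0 := Real.cos_nonneg_of_mem_Icc hx
    simp only [poisson, fourier_one_coe_re, Real.cos_add_pi, abs_neg, abs_of_nonneg hx0]
    ring
  rw [hcongr, kappa_eq_arctan_inv hs, smul_eq_mul]
  field_simp
  ring

/-- The error `cos (n y) sinh t / (cosh (n t) (cosh t - cos y))` of interpolating the Poisson kernel
by trigonometric polynomials of degree less than `n` at the zeros of `cos (n y)`. -/
noncomputable def poissonError (n : ℕ) (t : ℝ) (y : Circ) : ℝ :=
  poisson t y * (fourier (n : ℤ) y).re / Real.cosh (n * t)

theorem continuous_poissonError (n : ℕ) {t : ℝ} (ht : 0 < t) : Continuous (poissonError n t) :=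
  ((continuous_poisson ht).mul (Complex.continuous_re.comp (map_continuous _))).div_const _

/-- The factor `|cos(n y)|` depends only on `n y`, so the kernel may be replaced by the one with
parameter `n t`; the factor `cosh(n t)` then cancels. -/
theorem integral_abs_poissonError {n : ℕ} (hn : 1 ≤ n) {t : ℝ} (ht : 0 < t) :
    ∫ y, |poissonError n t y| ∂haarAddCircle = kappa (n * t) := by
  have hnt : 0 < (n : ℝ) * t := mul_pos (by exact_mod_cast hn) ht
  have hC := Real.cosh_pos (n * t)
  have h := integral_poisson_mul_comp_nsmul ht hn
    ⟨fun x => ((|(fourier 1 x).re| : ℝ) : ℂ), Complex.continuous_ofReal.comp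
      (Complex.continuous_re.comp (map_continuous _)).abs⟩
  simp only [ContinuousMap.coe_mk, fourier_eq_fourier_one_nsmul, one_mul,
    ← Complex.ofReal_mul, integral_complex_ofReal] at h
  have h' := Complex.ofReal_injective h
  rw [integral_poisson_mul_abs_cos hnt] at h'
  simp only [poissonError, abs_div, abs_mul, abs_of_pos (poisson_pos ht _), abs_of_pos hC]
  rw [integral_div, h']
  field_simp

/-- Multiplying by `cos(n y)` averages the Poisson coefficients at `j ± n`. For `|j| ≥ n` neither
shift crosses zero, so their sum is `2 cosh(n t) e^(-t|j|)`. -/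
theorem integral_poissonError_mul_fourier {n : ℕ} {t : ℝ} (ht : 0 < t) {j : ℤ}
    (hj : (n : ℝ) ≤ |(j : ℝ)|) :
    ∫ y, (poissonError n t y : ℂ) * fourier j y ∂haarAddCircle
      = ((Real.exp (-(t * |(j : ℝ)|)) : ℝ) : ℂ) := by
  have hC : (Real.cosh (n * t) : ℂ) ≠ 0 := Complex.ofReal_ne_zero.2 (Real.cosh_pos _).ne'
  have hfun : ∀ y, (poissonError n t y : ℂ) * fourier j y
      = (2 * (Real.cosh (n * t) : ℂ))⁻¹ * ((poisson t y : ℂ) * fourier (n + j) y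
        + (poisson t y : ℂ) * fourier (-n + j) y) := fun y => by
    have hre : ((fourier (n : ℤ) y).re : ℂ) = (fourier (n : ℤ) y + fourier (-(n : ℤ)) y) / 2 := by
      rw [fourier_neg, Complex.add_conj]; push_cast; ring
    rw [fourier_add, fourier_add, poissonError, Complex.ofReal_div, Complex.ofReal_mul, hre]
    field_simp
  simp only [hfun]
  rw [integral_const_mul, integral_add (integrable_ofReal_poisson_mul ht _)
    (integrable_ofReal_poisson_mul ht _), integral_poisson_mul_fourier ht,
    integral_poisson_mul_fourier ht, inv_mul_eq_div, div_eq_iff (mul_ne_zero two_ne_zero hC)]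
  norm_cast
  push_cast
  rw [Real.cosh_eq]
  have hn0 : (0 : ℝ) ≤ n := Nat.cast_nonneg n
  have key : Real.exp (-(t * |(n : ℝ) + j|)) + Real.exp (-(t * |-(n : ℝ) + j|))
      = Real.exp (-(t * |(j : ℝ)|)) * Real.exp (n * t)
        + Real.exp (-(t * |(j : ℝ)|)) * Real.exp (-(n * t)) := by
    rw [← Real.exp_add, ← Real.exp_add]
    rcases le_total 0 (j : ℝ) with h | h
    · rw [abs_of_nonneg h] at hj ⊢
      rw [abs_of_nonneg (by linarith), abs_of_nonneg (by linarith), add_comm]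
      ring_nf
    · rw [abs_of_nonpos h] at hj ⊢
      rw [abs_of_nonpos (by linarith), abs_of_nonpos (by linarith)]
      ring_nf
  rw [key]; ring

/-! ### Bounded realizations of the multipliers `j^(-2(m+1))` for `|j| ≥ n`. -/

/-- The kernel on `(0, ∞) × Circ` whose averages realize the multiplier `j^{-2(m+1)}`, `|j| ≥ n`. -/
noncomputable def powerKernel (n m : ℕ) (p : ℝ × Circ) : ℂ :=
  ((p.1 ^ (2 * m + 1) / ((2 * m + 1).factorial : ℝ) * poissonError n p.1 p.2 : ℝ) : ℂ)

/-- The reference measure `dt dy` on `(0, ∞) × Circ`. -/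
noncomputable abbrev halfCylinder : Measure (ℝ × Circ) :=
  (volume.restrict (Ioi (0 : ℝ))).prod haarAddCircle

theorem measurable_powerKernel (n m : ℕ) : Measurable (powerKernel n m) := by
  have hf : ∀ j : ℤ, Measurable fun p : ℝ × Circ => (fourier j p.2).re := fun j =>
    Complex.measurable_re.comp ((map_continuous _).measurable.comp measurable_snd)
  have hp : Measurable fun p : ℝ × Circ => poisson p.1 p.2 :=
    (Real.measurable_sinh.comp measurable_fst).div
      ((Real.measurable_cosh.comp measurable_fst).sub (hf 1))
  refine Complex.measurable_ofReal.comp (((measurable_fst.pow_const _).div_const _).mul ?_)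
  exact (hp.mul (hf n)).div (Real.measurable_cosh.comp (measurable_fst.const_mul _))

theorem integral_norm_powerKernel_fiber {n : ℕ} (hn : 1 ≤ n) (m : ℕ) {t : ℝ} (ht : 0 < t) :
    ∫ y, ‖powerKernel n m (t, y)‖ ∂haarAddCircle
      = t ^ (2 * m + 1) / ((2 * m + 1).factorial : ℝ) * kappa (n * t) := by
  simp only [powerKernel, Complex.norm_real, norm_mul, Real.norm_eq_abs]
  rw [integral_const_mul, integral_abs_poissonError hn ht, abs_of_nonneg (by positivity)]

theorem integrable_powerKernel {n : ℕ} (hn : 1 ≤ n) (m : ℕ) :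
    Integrable (powerKernel n m) halfCylinder := by
  have hn0 : (0 : ℝ) < n := by exact_mod_cast hn
  refine (integrable_prod_iff (measurable_powerKernel n m).aestronglyMeasurable).2 ⟨?_, ?_⟩
  · refine (ae_restrict_iff' measurableSet_Ioi).2 (Eventually.of_forall fun t ht => ?_)
    have hc : Continuous fun y => powerKernel n m (t, y) := by
      have := (continuous_poissonError n ht).const_mul
        (t ^ (2 * m + 1) / ((2 * m + 1).factorial : ℝ))
      exact Complex.continuous_ofReal.comp this
    exact integrable_circ ⟨fun y => powerKernel n m (t, y), hc⟩
  · refine (integrableOn_pow_mul_kappa hn0 m).congr ?_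
    refine (ae_restrict_iff' measurableSet_Ioi).2 (Eventually.of_forall fun t ht => ?_)
    exact (integral_norm_powerKernel_fiber hn m ht).symm

theorem integral_norm_powerKernel {n : ℕ} (hn : 1 ≤ n) (m : ℕ) :
    ∫ p, ‖powerKernel n m p‖ ∂halfCylinder
      = ∫ t in Ioi (0 : ℝ), t ^ (2 * m + 1) / ((2 * m + 1).factorial : ℝ) * kappa (n * t) := by
  rw [integral_prod _ (integrable_powerKernel hn m).norm]
  exact setIntegral_congr_fun measurableSet_Ioi fun t ht =>
    integral_norm_powerKernel_fiber hn m ht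

theorem integral_pow_mul_exp_neg {r : ℝ} (hr : 0 < r) (m : ℕ) :
    ∫ t in Ioi (0 : ℝ), t ^ (2 * m + 1) / ((2 * m + 1).factorial : ℝ) * Real.exp (-(t * r))
      = ((r ^ 2)⁻¹) ^ (m + 1) := by
  have h := Real.integral_rpow_mul_exp_neg_mul_Ioi (a := ((2 * m + 1 : ℕ) : ℝ) + 1)
    (by positivity) hr
  rw [add_sub_cancel_right, Real.Gamma_nat_eq_factorial] at h
  simp only [Real.rpow_natCast] at h
  have hpow : (1 / r) ^ (((2 * m + 1 : ℕ) : ℝ) + 1) = ((r ^ 2)⁻¹) ^ (m + 1) := by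
    rw [← Nat.cast_succ, Real.rpow_natCast, one_div, ← inv_pow, ← pow_mul]
    congr 1
  have hf : ((2 * m + 1).factorial : ℝ) ≠ 0 := by positivity
  rw [hpow] at h
  simp only [div_mul_eq_mul_div, mul_comm _ r]
  rw [integral_div, h, mul_div_assoc, div_self hf, mul_one]

/-- Integrating over the circle first gives `e^(-t|j|)`; the remaining integral in `t` is a Gamma
integral. -/
theorem integral_powerKernel_mul_fourier {n : ℕ} (hn : 1 ≤ n) (m : ℕ) {j : ℤ}
    (hj : (n : ℝ) ≤ |(j : ℝ)|) :
    ∫ p, powerKernel n m p * fourier j p.2 ∂halfCylinder = (((j : ℂ) ^ 2)⁻¹) ^ (m + 1) := by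
  have hi : Integrable (fun p => powerKernel n m p * fourier j p.2) halfCylinder := by
    refine (integrable_powerKernel hn m).mono ?_ (Eventually.of_forall fun p => ?_)
    · exact ((measurable_powerKernel n m).mul
        ((map_continuous _).measurable.comp measurable_snd)).aestronglyMeasurable
    · rw [norm_mul, norm_fourier_apply, mul_one]
  have hr : 0 < |(j : ℝ)| := lt_of_lt_of_le (by exact_mod_cast hn) hj
  rw [integral_prod _ hi]
  have hfiber : ∀ t ∈ Ioi (0 : ℝ), ∫ y, powerKernel n m (t, y) * fourier j y ∂haarAddCircle
      = ((t ^ (2 * m + 1) / ((2 * m + 1).factorial : ℝ) * Real.exp (-(t * |(j : ℝ)|)) : ℝ) : ℂ) :=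
    fun t ht => by
      simp only [powerKernel, Complex.ofReal_mul _ (poissonError _ _ _), mul_assoc]
      rw [integral_const_mul, integral_poissonError_mul_fourier ht hj, ← Complex.ofReal_mul]
  rw [setIntegral_congr_fun measurableSet_Ioi hfiber, integral_complex_ofReal,
    integral_pow_mul_exp_neg hr, sq_abs]
  push_cast
  rfl

/-- Bohr–Favard: a bounded realization of the `2(m+1)`-fold integral on frequencies `≥ n`. -/
theorem exists_inverse_power {n : ℕ} (hn : 1 ≤ n) (m : ℕ) :
    ∃ (G : C(Circ, ℂ) →L[ℂ] C(Circ, ℂ)) (g : ℤ → ℂ), HasMultiplier G g ∧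
      ‖G‖ ≤ ∫ t in Ioi (0 : ℝ),
        t ^ (2 * m + 1) / ((2 * m + 1).factorial : ℝ) * kappa (n * t) ∧
      ∀ j : ℤ, (n : ℝ) ≤ |(j : ℝ)| → g j = (((j : ℂ) ^ 2)⁻¹) ^ (m + 1) :=
  ⟨shiftAverage (integrable_powerKernel hn m) measurable_snd, _,
    fourierCoeff_shiftAverage _ _,
    (norm_shiftAverage_le _ _).trans_eq (integral_norm_powerKernel hn m),
    fun _ hj => integral_powerKernel_mul_fourier hn m hj⟩

/-- Norm bound for `f` from the coefficients of `(1 - U) f`, where `U` has multiplier `v_j / j²`. -/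
theorem norm_le_inv_cos_mul {n : ℕ} (hn : 1 ≤ n) {f w : C(Circ, ℂ)}
    {M : C(Circ, ℂ) →L[ℂ] C(Circ, ℂ)} {v : ℤ → ℂ} (hM : HasMultiplier M v)
    (hf : ∀ j : ℤ, fourierCoeff f j ≠ 0 → (n : ℝ) ≤ |(j : ℝ)|)
    (hw : ∀ j, fourierCoeff w j = (1 - v j * ((j : ℂ) ^ 2)⁻¹) * fourierCoeff f j)
    {c : ℝ} (h0 : 0 ≤ c) (hcn : c < n) (hMc : ‖M‖ ≤ c ^ 2) :
    ‖f‖ ≤ (Real.cos (Real.pi / 2 * (c / n)))⁻¹ * ‖w‖ := by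
  choose G g hG hB hg using fun m => exists_inverse_power hn m
  have h := norm_le_of_neumann hM hG (fun m j hj => hg m j (hf j hj)) hw hMc hB
    (sum_moment_kappa_le h0 hcn)
  rwa [add_sub_cancel] at h

/-! ### Algebra of multipliers, translations and second differences. -/

theorem HasMultiplier.add {L L' : C(Circ, ℂ) →L[ℂ] C(Circ, ℂ)} {l l' : ℤ → ℂ}
    (h : HasMultiplier L l) (h' : HasMultiplier L' l') :
    HasMultiplier (L + L') (fun j => l j + l' j) := fun f j => by
  rw [add_apply, ContinuousMap.coe_add,
    fourierCoeff.add (integrable_circ _) (integrable_circ _), Pi.add_apply, h, h', add_mul]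

theorem HasMultiplier.smul {L : C(Circ, ℂ) →L[ℂ] C(Circ, ℂ)} {l : ℤ → ℂ}
    (h : HasMultiplier L l) (c : ℂ) : HasMultiplier (c • L) (fun j => c * l j) := fun f j => by
  rw [smul_apply, ContinuousMap.coe_smul,
    fourierCoeff.const_smul, h, smul_eq_mul, mul_assoc]

theorem HasMultiplier.one : HasMultiplier 1 (fun _ => 1) := fun f j => by
  rw [one_mul, one_apply_eq_self]

theorem HasMultiplier.sum {L : ℕ → C(Circ, ℂ) →L[ℂ] C(Circ, ℂ)} {l : ℕ → ℤ → ℂ}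
    (h : ∀ i, HasMultiplier (L i) (l i)) (N : ℕ) :
    HasMultiplier (∑ i ∈ Finset.range N, L i) (fun j => ∑ i ∈ Finset.range N, l i j) := by
  induction N with
  | zero => intro f j; simp [fourierCoeff]
  | succ N ih =>
    simp only [Finset.sum_range_succ]
    exact ih.add (h N)

theorem fourier_coe_eq_exp (j : ℤ) (x : ℝ) :
    fourier j (x : Circ) = Complex.exp ((j * x : ℝ) * Complex.I) := by
  rw [fourier_coe_apply]
  congr 1
  have : (Real.pi : ℂ) ≠ 0 := Complex.ofReal_ne_zero.2 Real.pi_ne_zero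
  push_cast
  field_simp

theorem fourier_coe_add_fourier_coe_neg (j : ℤ) (x : ℝ) :
    fourier j (x : Circ) + fourier j ((-x : ℝ) : Circ) = ((2 * Real.cos (j * x) : ℝ) : ℂ) := by
  rw [fourier_coe_eq_exp, fourier_coe_eq_exp, mul_neg, Complex.ofReal_neg, neg_mul,
    Complex.ofReal_mul 2, Complex.ofReal_cos, Complex.cos]
  push_cast
  rw [neg_mul]
  ring

/-- Translation `f ↦ f(· + y)`. -/
noncomputable def translate (y : Circ) : C(Circ, ℂ) →L[ℂ] C(Circ, ℂ) :=
  shiftAverage (ν := Measure.dirac ()) (q := fun _ => 1) (s := fun _ => y)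
    (integrable_const _) measurable_const

theorem norm_translate_le (y : Circ) : ‖translate y‖ ≤ 1 :=
  (norm_shiftAverage_le _ _).trans (by simp)

theorem hasMultiplier_translate (y : Circ) : HasMultiplier (translate y) (fun j => fourier j y) :=
  fun f j => by rw [translate, fourierCoeff_shiftAverage]; simp

/-- `∑ i < k, b i (2 f - f(· + (i + 1) h) - f(· - (i + 1) h))`. -/
noncomputable def secondDiff (k : ℕ) (b : ℕ → ℝ) (h : ℝ) : C(Circ, ℂ) →L[ℂ] C(Circ, ℂ) :=
  ∑ i ∈ Finset.range k, (b i : ℂ) • ((2 : ℂ) • 1 + (-1 : ℂ) •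
    (translate (((i + 1 : ℝ) * h : ℝ) : Circ) + translate ((-((i + 1 : ℝ) * h) : ℝ) : Circ)))

theorem hasMultiplier_secondDiff (k : ℕ) (b : ℕ → ℝ) (h : ℝ) :
    HasMultiplier (secondDiff k b h) (fun j =>
      ((∑ i ∈ Finset.range k, b i * (2 - 2 * Real.cos (j * ((i + 1 : ℝ) * h))) : ℝ) : ℂ)) := by
  have := HasMultiplier.sum (fun i => (((HasMultiplier.one.smul 2).add
    (((hasMultiplier_translate (((i + 1 : ℝ) * h : ℝ) : Circ)).add
      (hasMultiplier_translate ((-((i + 1 : ℝ) * h) : ℝ) : Circ))).smul (-1))).smul (b i : ℂ))) k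
  refine fun f j => (this f j).trans (congrArg (· * fourierCoeff f j) ?_)
  beta_reduce
  rw [Complex.ofReal_sum]
  refine Finset.sum_congr rfl fun i _ => ?_
  rw [fourier_coe_add_fourier_coe_neg]
  push_cast
  ring

/-- The multiples of the identity are collected, signs included, before the triangle inequality is
applied. Each negative `b i` then cancels against its own `|b i|`, which is why only odd indices
survive in `mu`. -/
theorem norm_secondDiff_le {k : ℕ} {b : ℕ → ℝ} (hb : 0 ≤ ∑ i ∈ Finset.range k, b i) (h : ℝ) :
    ‖secondDiff k b h‖ ≤ ∑ i ∈ Finset.range k, 2 * (b i + |b i|) := by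
  set D : ℕ → C(Circ, ℂ) →L[ℂ] C(Circ, ℂ) := fun i =>
    translate (((i + 1 : ℝ) * h : ℝ) : Circ) + translate ((-((i + 1 : ℝ) * h) : ℝ) : Circ) with hD
  have hDn : ∀ i, ‖D i‖ ≤ 2 := fun i =>
    (norm_add_le _ _).trans ((add_le_add (norm_translate_le _) (norm_translate_le _)).trans_eq
      (by norm_num))
  have heq : secondDiff k b h = ((2 * ∑ i ∈ Finset.range k, b i : ℝ) : ℂ) • 1
      + ∑ i ∈ Finset.range k, (-(b i) : ℂ) • D i := by
    rw [secondDiff, Complex.ofReal_mul, Complex.ofReal_sum, Finset.mul_sum, Finset.sum_smul,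
      ← Finset.sum_add_distrib]
    refine Finset.sum_congr rfl fun i _ => ?_
    rw [smul_add, smul_smul, smul_smul, mul_neg_one, mul_comm (b i : ℂ), Complex.ofReal_ofNat]
  have hone : ‖(1 : C(Circ, ℂ) →L[ℂ] C(Circ, ℂ))‖ ≤ 1 := ContinuousLinearMap.norm_id_le
  rw [heq]
  refine (norm_add_le _ _).trans ?_
  have h1 : ‖((2 * ∑ i ∈ Finset.range k, b i : ℝ) : ℂ) • (1 : C(Circ, ℂ) →L[ℂ] C(Circ, ℂ))‖
      ≤ 2 * ∑ i ∈ Finset.range k, b i := by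
    rw [norm_smul, Complex.norm_real, Real.norm_of_nonneg (by positivity)]
    exact mul_le_of_le_one_right (by positivity) hone
  have h2 : ‖∑ i ∈ Finset.range k, (-(b i) : ℂ) • D i‖ ≤ ∑ i ∈ Finset.range k, |b i| * 2 := by
    refine (norm_sum_le _ _).trans (Finset.sum_le_sum fun i _ => ?_)
    rw [norm_smul, norm_neg, Complex.norm_real, Real.norm_eq_abs]
    exact mul_le_mul_of_nonneg_left (hDn i) (abs_nonneg _)
  refine (add_le_add h1 h2).trans_eq ?_
  rw [Finset.mul_sum, ← Finset.sum_add_distrib]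
  exact Finset.sum_congr rfl fun i _ => by ring

/-! ### Binomial ratios, the constant `μ` and the norm of the second-difference operator. -/

theorem alternating_sum_mem_Icc {d : ℕ → ℝ} (hd : Antitone d) (h0 : ∀ i, 0 ≤ d i) (k : ℕ) :
    0 ≤ ∑ i ∈ Finset.range k, (-1 : ℝ) ^ i * d i ∧
      ∑ i ∈ Finset.range k, (-1 : ℝ) ^ i * d i ≤ d 0 := by
  induction k generalizing d with
  | zero => simpa using h0 0
  | succ k ih =>
    obtain ⟨h1, h2⟩ := ih (d := fun i => d (i + 1)) (fun a b hab => hd (by lia)) (fun i => h0 _)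
    have h3 : d (0 + 1) ≤ d 0 := hd (by lia)
    have h4 : ∑ i ∈ Finset.range k, (-1 : ℝ) ^ (i + 1) * d (i + 1)
        = -∑ i ∈ Finset.range k, (-1 : ℝ) ^ i * d (i + 1) := by
      rw [← Finset.sum_neg_distrib]
      exact Finset.sum_congr rfl fun i _ => by ring
    -- Peeling off the first term gives `d 0` minus an alternating sum for the shifted sequence,
    -- which lies in `[0, d 1]`.
    rw [Finset.sum_range_succ', h4, pow_zero, one_mul]
    constructor <;> linarith

/-- `a_i = (2k choose k+i) / (2k choose k)`. -/
noncomputable def chooseRatio (k i : ℕ) : ℝ :=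
  ((2 * k).choose (k + i) : ℝ) / ((2 * k).choose k : ℝ)

theorem chooseRatio_nonneg (k i : ℕ) : 0 ≤ chooseRatio k i := by
  unfold chooseRatio; positivity

theorem chooseRatio_le_one (k i : ℕ) : chooseRatio k i ≤ 1 := by
  have h := Nat.choose_le_middle (k + i) (2 * k)
  rw [Nat.mul_div_cancel_left _ two_pos] at h
  exact div_le_one_of_le₀ (by exact_mod_cast h) (by positivity)

theorem antitone_chooseRatio (k : ℕ) : Antitone (chooseRatio k) := by
  refine antitone_nat_of_succ_le fun i => div_le_div_of_nonneg_right ?_ (by positivity)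
  have h := Nat.choose_succ_right_eq (2 * k) (k + i)
  have h2 : 2 * k - (k + i) ≤ k + i + 1 := by lia
  have h3 : (2 * k).choose (k + i + 1) ≤ (2 * k).choose (k + i) := by
    refine Nat.le_of_mul_le_mul_right ?_ (Nat.succ_pos (k + i))
    exact h.le.trans (Nat.mul_le_mul_left _ h2)
  exact_mod_cast h3

theorem sum_filter_odd_Icc (F : ℕ → ℝ) (k : ℕ) :
    ∑ i ∈ (Finset.Icc 1 k).filter (fun i => Odd i), F i
      = ∑ i ∈ Finset.range k, if Even i then F (i + 1) else 0 := by
  rw [Finset.sum_filter]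
  induction k with
  | zero => simp
  | succ k ih =>
    rw [Finset.sum_Icc_succ_top (by lia), Finset.sum_range_succ, ih]
    simp only [Nat.odd_add_one, Nat.not_odd_iff_even]

theorem mu_nonneg (k : ℕ) : 0 ≤ mu k := Real.sqrt_nonneg _

theorem mu_sq (k : ℕ) : mu k ^ 2 = 8 / Real.pi ^ 2 *
    ∑ i ∈ Finset.range k, if Even i then chooseRatio k (i + 1) / ((i : ℝ) + 1) ^ 2 else 0 := by
  rw [mu, Real.sq_sqrt (mul_nonneg (by positivity)
    (Finset.sum_nonneg fun i _ => by positivity)), sum_filter_odd_Icc]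
  simp only [chooseRatio, Nat.cast_add, Nat.cast_one]

theorem hasSum_inv_odd_sq : HasSum (fun m : ℕ => 1 / (2 * (m : ℝ) + 1) ^ 2) (Real.pi ^ 2 / 8) := by
  set F : ℕ → ℝ := fun l => 1 / (l : ℝ) ^ 2 with hF
  have hz : HasSum F (Real.pi ^ 2 / 6) := hasSum_zeta_two
  have he : HasSum (fun m : ℕ => F (2 * m)) (Real.pi ^ 2 / 6 / 4) := by
    have : (fun m : ℕ => F (2 * m)) = fun m => F m / 4 := by
      funext m
      simp only [hF, Nat.cast_mul, Nat.cast_ofNat, mul_pow]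
      rw [div_div]
      norm_num [mul_comm]
    rw [this]
    exact hz.div_const 4
  have hs : Summable fun m : ℕ => F (2 * m + 1) :=
    hz.summable.comp_injective (i := fun m : ℕ => 2 * m + 1) fun a b h => by
      simp only at h; lia
  have ho := hs.hasSum
  have := (he.even_add_odd ho).unique hz
  have hval : ∑' m : ℕ, F (2 * m + 1) = Real.pi ^ 2 / 8 := by linarith
  rw [hval] at ho
  simpa only [hF, Nat.cast_add, Nat.cast_mul, Nat.cast_ofNat, Nat.cast_one] using ho

/-- Each ratio `a_i` is at most `1`, and the inverse odd squares sum to `π²/8`. -/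
theorem mu_le_one (k : ℕ) : mu k ≤ 1 := by
  refine Real.sqrt_le_one.2 ?_
  have h : ∑ i ∈ Finset.range k, (if Even i then 1 / ((i : ℝ) + 1) ^ 2 else 0)
      ≤ Real.pi ^ 2 / 8 := by
    have hinj : Function.Injective fun m : ℕ => 2 * m := fun a b h => by simp only at h; lia
    have hs : HasSum (fun i : ℕ => if Even i then 1 / ((i : ℝ) + 1) ^ 2 else 0)
        (Real.pi ^ 2 / 8) := by
      refine (hinj.hasSum_iff fun i hi => ?_).1 ?_
      · rw [if_neg]
        rintro ⟨r, rfl⟩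
        exact hi ⟨r, by simp only; lia⟩
      · simpa [Function.comp_def] using hasSum_inv_odd_sq
    exact sum_le_hasSum _ (fun i _ => by split_ifs <;> positivity) hs
  have h2 := mu_sq k
  have h3 : mu k ^ 2 ≤ 1 := by
    rw [h2]
    calc _ ≤ 8 / Real.pi ^ 2 * (Real.pi ^ 2 / 8) := by
          refine mul_le_mul_of_nonneg_left (le_trans (Finset.sum_le_sum fun i _ => ?_) h)
            (by positivity)
          split_ifs
          · exact div_le_div_of_nonneg_right (chooseRatio_le_one _ _) (by positivity)
          · exact le_rfl
      _ = 1 := by field_simp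
  rw [mu, Real.sq_sqrt] at h3
  · exact h3
  · exact mul_nonneg (by positivity) (Finset.sum_nonneg fun i _ => by positivity)

/-- The weights of the second differences in the averaged difference of order `2k`. -/
noncomputable def diffWeight (k : ℕ) (h : ℝ) (i : ℕ) : ℝ :=
  (-1) ^ i * (2 * chooseRatio k (i + 1) / (((i : ℝ) + 1) * h) ^ 2)

/-- The weights alternate in sign with decreasing absolute values, so their sum is nonnegative. The
summand `2 (b + |b|)` is `4 |b|` at even `i`, that is at odd `i + 1`, and zero elsewhere. -/
theorem norm_secondDiff_diffWeight_le (k : ℕ) {h : ℝ} (hh : 0 < h) :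
    ‖secondDiff k (diffWeight k h) h‖ ≤ (Real.pi * mu k / h) ^ 2 := by
  set d : ℕ → ℝ := fun i => 2 * chooseRatio k (i + 1) / (((i : ℝ) + 1) * h) ^ 2 with hd
  have hd0 : ∀ i, 0 ≤ d i := fun i => by
    have := chooseRatio_nonneg k (i + 1)
    simp only [hd]; positivity
  have hanti : Antitone d := fun i j hij => by
    have h1 := antitone_chooseRatio k (Nat.succ_le_succ hij)
    have h2 : (i : ℝ) ≤ j := by exact_mod_cast hij
    refine div_le_div₀ (mul_nonneg two_pos.le (chooseRatio_nonneg _ _)) (by linarith)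
      (by positivity) ?_
    gcongr
  refine (norm_secondDiff_le (alternating_sum_mem_Icc hanti hd0 k).1 h).trans_eq ?_
  rw [div_pow, mul_pow, mu_sq, Finset.mul_sum, Finset.mul_sum, Finset.sum_div]
  refine Finset.sum_congr rfl fun i _ => ?_
  rw [abs_mul, abs_pow, abs_neg, abs_one, one_pow, one_mul, abs_of_nonneg (hd0 i)]
  split_ifs with he
  · rw [he.neg_one_pow]
    simp only [hd]
    field_simp
    ring
  · rw [(Nat.not_even_iff_odd.1 he).neg_one_pow]
    ring

theorem gammaStar_two_mul (k : ℕ) : gammaStar (2 * k) = 1 / ((2 * k).choose k : ℝ) := by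
  rw [gammaStar, Nat.mul_div_cancel_left _ two_pos]

theorem gammaStar_nonneg (r : ℕ) : 0 ≤ gammaStar r := by unfold gammaStar; positivity

theorem sum_range_two_mul_add_one {E : Type*} [AddCommMonoid E] (F : ℕ → E) (k : ℕ) :
    ∑ i ∈ Finset.range (2 * k + 1), F i
      = F k + ∑ i ∈ Finset.range k, (F (k + 1 + i) + F (k - 1 - i)) := by
  rw [show 2 * k + 1 = k + 1 + k by ring, Finset.sum_range_add, Finset.sum_range_succ,
    Finset.sum_add_distrib, Finset.sum_range_reflect]
  abel

/-! ### Averaged central differences and their multiplier. -/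

/-- The weight `(2/h)(1 - t/h)` on `(0, h]`. -/
noncomputable def hatWeight (h t : ℝ) : ℝ := 2 / h * (1 - t / h)

theorem continuous_hatWeight (h : ℝ) : Continuous (hatWeight h) := by
  unfold hatWeight; fun_prop

theorem hatWeight_nonneg {h t : ℝ} (ht : t ∈ Ioc 0 h) : 0 ≤ hatWeight h t := by
  have hh : 0 < h := ht.1.trans_le ht.2
  have := (div_le_one hh).2 ht.2
  exact mul_nonneg (by positivity) (by linarith)

theorem integral_hatWeight {h : ℝ} (hh : 0 < h) : ∫ t in Ioc 0 h, hatWeight h t = 1 := by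
  rw [← intervalIntegral.integral_of_le hh.le]
  have hd : ∀ t ∈ uIcc 0 h, HasDerivAt (fun t => 2 / h * (t - t ^ 2 / (2 * h))) (hatWeight h t) t :=
    fun t _ => by
      refine (((hasDerivAt_id t).sub ((hasDerivAt_pow 2 t).div_const (2 * h))).const_mul
        (2 / h)).congr_deriv ?_
      unfold hatWeight
      field_simp
      norm_num
      ring
  rw [intervalIntegral.integral_eq_sub_of_hasDerivAt hd
    ((continuous_hatWeight h).intervalIntegrable _ _)]
  field_simp
  norm_num

/-- This is the reason for the linear weight: its cosine transform is a second-difference symbol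
divided by the square of the frequency. -/
theorem integral_hatWeight_mul_cos {h θ : ℝ} (hh : 0 < h) (hθ : θ ≠ 0) :
    ∫ t in Ioc 0 h, hatWeight h t * (2 * Real.cos (θ * t))
      = 2 * (2 - 2 * Real.cos (θ * h)) / (θ * h) ^ 2 := by
  rw [← intervalIntegral.integral_of_le hh.le]
  have hd : ∀ t ∈ uIcc 0 h, HasDerivAt (fun t => 4 / h * ((1 - t / h) * (Real.sin (θ * t) / θ)
      - Real.cos (θ * t) / (h * θ ^ 2))) (hatWeight h t * (2 * Real.cos (θ * t))) t :=
    fun t _ => by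
      have hl : HasDerivAt (fun t : ℝ => θ * t) θ t := by
        simpa using! (hasDerivAt_id t).const_mul θ
      refine (((((hasDerivAt_id t).div_const h).const_sub 1).mul (hl.sin.div_const θ)).sub
        (hl.cos.div_const (h * θ ^ 2))).const_mul (4 / h) |>.congr_deriv ?_
      unfold hatWeight
      simp only [id]
      field_simp
      ring
  rw [intervalIntegral.integral_eq_sub_of_hasDerivAt hd
    (((continuous_hatWeight h).mul (by fun_prop)).intervalIntegrable _ _)]
  simp only [mul_zero, Real.sin_zero, Real.cos_zero]
  field_simp
  ring

theorem integrable_hatWeight (h : ℝ) :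
    Integrable (fun t => (hatWeight h t : ℂ)) (volume.restrict (Ioc 0 h)) :=
  (Complex.continuous_ofReal.comp (continuous_hatWeight h)).integrableOn_Ioc

theorem measurable_coe_mul (r : ℝ) : Measurable fun t : ℝ => ((r * t : ℝ) : Circ) :=
  ((AddCircle.continuous_mk' _).comp (continuous_const_mul r)).measurable

/-- The average `∫₀ʰ (2/h)(1 - t/h) f(· + r t) dt`. -/
noncomputable def hatAverage (h r : ℝ) : C(Circ, ℂ) →L[ℂ] C(Circ, ℂ) :=
  shiftAverage (integrable_hatWeight h) (measurable_coe_mul r)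

/-- The multiplier of `hatAverage h r`. -/
noncomputable def hatSymbol (h r : ℝ) (j : ℤ) : ℂ :=
  ∫ t in Ioc 0 h, (hatWeight h t : ℂ) * fourier j ((r * t : ℝ) : Circ)

theorem hasMultiplier_hatAverage (h r : ℝ) : HasMultiplier (hatAverage h r) (hatSymbol h r) :=
  fourierCoeff_shiftAverage _ _

theorem hatSymbol_zero {h : ℝ} (hh : 0 < h) (j : ℤ) : hatSymbol h 0 j = 1 := by
  simp only [hatSymbol, zero_mul, QuotientAddGroup.mk_zero, fourier_eval_zero, mul_one]
  rw [integral_complex_ofReal, integral_hatWeight hh, Complex.ofReal_one]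

theorem hatSymbol_add_neg {h r : ℝ} (hh : 0 < h) (hr : r ≠ 0) {j : ℤ} (hj : j ≠ 0) :
    hatSymbol h r j + hatSymbol h (-r) j
      = ((2 * (2 - 2 * Real.cos (j * (r * h))) / (j * (r * h)) ^ 2 : ℝ) : ℂ) := by
  have hi : ∀ r : ℝ, Integrable (fun t => (hatWeight h t : ℂ) * fourier j ((r * t : ℝ) : Circ))
      (volume.restrict (Ioc 0 h)) := fun r =>
    ((Complex.continuous_ofReal.comp (continuous_hatWeight h)).mul ((map_continuous _).comp
      ((AddCircle.continuous_mk' _).comp (continuous_const_mul r)))).integrableOn_Ioc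
  have hjr : (j : ℝ) * r ≠ 0 := mul_ne_zero (Int.cast_ne_zero.2 hj) hr
  rw [hatSymbol, hatSymbol, ← integral_add (hi r) (hi (-r)), ← mul_assoc,
    ← integral_hatWeight_mul_cos hh hjr, ← integral_complex_ofReal]
  refine integral_congr_ae (Eventually.of_forall fun t => ?_)
  simp only
  rw [← mul_add, neg_mul, fourier_coe_add_fourier_coe_neg, ← Complex.ofReal_mul,
    mul_assoc (j : ℝ)]

/-- The coefficient `(-1)^{k+i} (2k choose i) / (2k choose k)` of the normalized central
difference. -/
noncomputable def centralWeight (k i : ℕ) : ℝ :=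
  gammaStar (2 * k) * ((-1) ^ k * ((-1) ^ i * ((2 * k).choose i : ℝ)))

/-- The average of normalized central differences of order `2k` with steps in `(0, h]`. -/
noncomputable def averagedDiff (k : ℕ) (h : ℝ) : C(Circ, ℂ) →L[ℂ] C(Circ, ℂ) :=
  ∑ i ∈ Finset.range (2 * k + 1), (centralWeight k i : ℂ) • hatAverage h ((i : ℝ) - k)

theorem hasMultiplier_averagedDiff (k : ℕ) (h : ℝ) :
    HasMultiplier (averagedDiff k h) (fun j =>
      ∑ i ∈ Finset.range (2 * k + 1), (centralWeight k i : ℂ) * hatSymbol h ((i : ℝ) - k) j) :=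
  HasMultiplier.sum (fun i => (hasMultiplier_hatAverage h ((i : ℝ) - k)).smul _) _

theorem centralWeight_self (k : ℕ) : centralWeight k k = 1 := by
  have : ((2 * k).choose k : ℝ) ≠ 0 :=
    Nat.cast_ne_zero.2 (Nat.choose_pos (by lia)).ne'
  rw [centralWeight, gammaStar_two_mul, ← mul_assoc ((-1 : ℝ) ^ k), ← mul_pow, neg_one_mul, neg_neg,
    one_pow, one_mul, one_div, inv_mul_cancel₀ this]

theorem centralWeight_add (k i : ℕ) :
    centralWeight k (k + 1 + i) = -((-1) ^ i * chooseRatio k (i + 1)) := by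
  rw [centralWeight, gammaStar_two_mul, chooseRatio, show k + (i + 1) = k + 1 + i by ring]
  have : (-1 : ℝ) ^ k * (-1) ^ (k + 1 + i) = -(-1) ^ i := by
    rw [← pow_add, show k + (k + 1 + i) = 2 * k + (i + 1) by ring, pow_add, pow_mul]
    norm_num [pow_succ]
  rw [← mul_assoc ((-1 : ℝ) ^ k), this]
  ring

theorem centralWeight_sub {k i : ℕ} (hi : i < k) :
    centralWeight k (k - 1 - i) = -((-1) ^ i * chooseRatio k (i + 1)) := by
  rw [← centralWeight_add, centralWeight, centralWeight]
  obtain ⟨l, rfl⟩ : ∃ l, k = l + i + 1 := ⟨k - 1 - i, by lia⟩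
  have h1 : l + i + 1 - 1 - i = l := by lia
  have h2 : (2 * (l + i + 1)).choose (l + i + 1 + 1 + i) = (2 * (l + i + 1)).choose l := by
    rw [← Nat.choose_symm (by lia : l ≤ 2 * (l + i + 1))]
    congr 1; lia
  have h3 : (-1 : ℝ) ^ (l + i + 1 + 1 + i) = (-1) ^ l := by
    rw [show l + i + 1 + 1 + i = 2 * (i + 1) + l by ring, pow_add, pow_mul]
    norm_num
  rw [h1, h2, h3]

/-- The central term contributes `1`. The terms at `±(i + 1)` have equal coefficients, so their
symbols combine into that of a second difference of step `(i + 1) h` over `j²`. -/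
theorem averagedDiff_symbol (k : ℕ) {h : ℝ} (hh : 0 < h) {j : ℤ} (hj : j ≠ 0) :
    ∑ i ∈ Finset.range (2 * k + 1), (centralWeight k i : ℂ) * hatSymbol h ((i : ℝ) - k) j
      = 1 - ((∑ i ∈ Finset.range k,
          diffWeight k h i * (2 - 2 * Real.cos (j * ((i + 1 : ℝ) * h))) : ℝ) : ℂ)
            * ((j : ℂ) ^ 2)⁻¹ := by
  have hjR : (j : ℝ) ≠ 0 := Int.cast_ne_zero.2 hj
  rw [sum_range_two_mul_add_one, centralWeight_self, sub_self, hatSymbol_zero hh,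
    Complex.ofReal_one, one_mul, sub_eq_add_neg, Complex.ofReal_sum, Finset.sum_mul,
    ← Finset.sum_neg_distrib]
  congr 1
  refine Finset.sum_congr rfl fun i hi => ?_
  have hik := Finset.mem_range.1 hi
  have e1 : ((k + 1 + i : ℕ) : ℝ) - k = i + 1 := by push_cast; ring
  have e2 : ((k - 1 - i : ℕ) : ℝ) - k = -((i : ℝ) + 1) := by
    rw [Nat.sub_sub, Nat.cast_sub (by lia)]; push_cast; ring
  rw [centralWeight_add, centralWeight_sub hik, e1, e2, ← mul_add,
    hatSymbol_add_neg hh (by positivity) hj, diffWeight]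
  have hi1 : (i : ℝ) + 1 ≠ 0 := by positivity
  have hcast : ((j : ℂ) ^ 2)⁻¹ = (((j : ℝ) ^ 2)⁻¹ : ℝ) := by push_cast; rfl
  rw [hcast, ← Complex.ofReal_mul, ← Complex.ofReal_mul, ← Complex.ofReal_neg]
  congr 1
  field_simp

/-! ### Passage from the line to the circle, and the estimate for `f`. -/

section Function

variable {f : ℝ → ℝ}

/-- A continuous `2π`-periodic real function as a complex function on the circle. -/
noncomputable def toCirc (hf : Continuous f) (hper : Function.Periodic f (2 * Real.pi)) :
    C(Circ, ℂ) :=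
  ⟨fun x => ((hper.lift x : ℝ) : ℂ),
    Complex.continuous_ofReal.comp (continuous_coinduced_dom.2 hf)⟩

theorem toCirc_coe (hf : Continuous f) (hper : Function.Periodic f (2 * Real.pi)) (x : ℝ) :
    toCirc hf hper (x : Circ) = f x := rfl

theorem supNorm_le_norm_toCirc (hf : Continuous f) (hper : Function.Periodic f (2 * Real.pi)) :
    supNorm f ≤ ‖toCirc hf hper‖ :=
  ciSup_le fun x => by
    have := (toCirc hf hper).norm_coe_le_norm (x : Circ)
    rwa [toCirc_coe, Complex.norm_real, Real.norm_eq_abs] at this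

theorem abs_fwdDelta_le_modulus (hf : Continuous f) (hper : Function.Periodic f (2 * Real.pi))
    (r : ℕ) {h t : ℝ} (ht : t ∈ Ioc 0 h) (x : ℝ) : |fwdDelta r t f x| ≤ modulus r f h := by
  have hc : Continuous (fwdDelta r t f) := by
    unfold fwdDelta
    fun_prop
  have hp : Function.Periodic (fwdDelta r t f) (2 * Real.pi) := fun x => by
    unfold fwdDelta
    refine Finset.sum_congr rfl fun i _ => ?_
    rw [add_right_comm, hper]
  exact (abs_le_supNorm hc hp x).trans
    (le_csSup (bddAbove_modulus hf hper r h) ⟨t, ht, rfl⟩)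

theorem norm_averagedDiff_le (hf : Continuous f) (hper : Function.Periodic f (2 * Real.pi))
    (k : ℕ) {h : ℝ} (hh : 0 < h) :
    ‖averagedDiff k h (toCirc hf hper)‖ ≤ gammaStar (2 * k) * modulus (2 * k) f h := by
  have hω : 0 ≤ modulus (2 * k) f h :=
    (abs_nonneg _).trans (abs_fwdDelta_le_modulus hf hper (2 * k) ⟨hh, le_rfl⟩ 0)
  refine (ContinuousMap.norm_le _ (mul_nonneg (gammaStar_nonneg _) hω)).2 fun x => ?_
  induction x using QuotientAddGroup.induction_on with
  | H x =>
  -- Starting the forward difference at `x - k t` centres it; the sign `(-1)^k` makes the central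
  -- coefficient positive and has no effect on the norm.
  have hval : averagedDiff k h (toCirc hf hper) (x : Circ) = ∫ t in Ioc 0 h,
      ((hatWeight h t * (gammaStar (2 * k) * ((-1) ^ k * fwdDelta (2 * k) t f (x - k * t))) : ℝ)
        : ℂ) := by
    have hterm : ∀ i ∈ Finset.range (2 * k + 1),
        Integrable (fun t => (centralWeight k i : ℂ) * ((hatWeight h t : ℂ) *
          toCirc hf hper ((x : Circ) + ((((i : ℝ) - k) * t : ℝ) : Circ))))
          (volume.restrict (Ioc 0 h)) := fun i _ =>
      (integrable_mul_shift (integrable_hatWeight h) (measurable_coe_mul _) _ _).const_mul _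
    simp only [averagedDiff, sum_apply, ContinuousMap.coe_sum, Finset.sum_apply,
      smul_apply, ContinuousMap.coe_smul, Pi.smul_apply, smul_eq_mul, hatAverage,
      shiftAverage_apply, ← integral_const_mul]
    rw [← integral_finsetSum _ hterm]
    refine integral_congr_ae (Eventually.of_forall fun t => ?_)
    simp only [fwdDelta, Finset.mul_sum, Complex.ofReal_sum]
    refine Finset.sum_congr rfl fun i _ => ?_
    rw [← AddCircle.coe_add, toCirc_coe, centralWeight,
      show x - k * t + i * t = x + ((i : ℝ) - k) * t by ring]
    push_cast
    ring
  rw [hval]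
  have hint : Integrable (fun t => hatWeight h t * (gammaStar (2 * k) * modulus (2 * k) f h))
      (volume.restrict (Ioc 0 h)) :=
    ((continuous_hatWeight h).integrableOn_Ioc).mul_const _
  refine (norm_integral_le_of_norm_le hint ?_).trans_eq ?_
  · refine (ae_restrict_iff' measurableSet_Ioc).2 (Eventually.of_forall fun t ht => ?_)
    rw [Complex.norm_real, norm_mul, norm_mul, norm_mul, norm_pow, norm_neg, norm_one, one_pow,
      one_mul, Real.norm_of_nonneg (hatWeight_nonneg ht), Real.norm_of_nonneg (gammaStar_nonneg _)]
    exact mul_le_mul_of_nonneg_left (mul_le_mul_of_nonneg_left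
      (abs_fwdDelta_le_modulus hf hper _ ht _) (gammaStar_nonneg _)) (hatWeight_nonneg ht)
  · rw [integral_mul_const, integral_hatWeight hh, one_mul]

theorem isTrigPoly_cos {l m : ℕ} (h : l ≤ m) : IsTrigPoly m (fun x => Real.cos (l * x)) :=
  ⟨Pi.single l 1, 0, fun x => by
    rw [Finset.sum_eq_single_of_mem l (Finset.mem_range.2 (by lia)) fun j _ hj => by
      simp [hj]]
    simp⟩

theorem isTrigPoly_sin {l m : ℕ} (h : l ≤ m) : IsTrigPoly m (fun x => Real.sin (l * x)) :=
  ⟨0, Pi.single l 1, fun x => by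
    rw [Finset.sum_eq_single_of_mem l (Finset.mem_range.2 (by lia)) fun j _ hj => by
      simp [hj]]
    simp⟩

/-- The complex coefficient splits into a cosine and a sine integral; parity reduces negative `j` to
`|j|`. -/
theorem fourierCoeff_toCirc_eq_zero (hf : Continuous f)
    (hper : Function.Periodic f (2 * Real.pi)) {m : ℕ} (horth : OrthTrigPoly m f) {j : ℤ}
    (hj : j.natAbs ≤ m) : fourierCoeff (toCirc hf hper) j = 0 := by
  have hcos : ∫ x in (-Real.pi)..Real.pi, f x * Real.cos (j * x) = 0 := by
    rw [← horth _ (isTrigPoly_cos hj)]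
    refine intervalIntegral.integral_congr fun x _ => ?_
    rw [Nat.cast_natAbs, Int.cast_abs, ← Real.cos_abs ((j : ℝ) * x), ← Real.cos_abs (|(j : ℝ)| * x),
      abs_mul, abs_mul, abs_abs]
  have hsin : ∫ x in (-Real.pi)..Real.pi, f x * Real.sin (j * x) = 0 := by
    have h := horth _ (isTrigPoly_sin hj)
    rcases le_total 0 j with h0 | h0
    · rw [← h]
      refine intervalIntegral.integral_congr fun x _ => ?_
      rw [Nat.cast_natAbs, abs_of_nonneg h0]
    · rw [← neg_eq_zero, ← intervalIntegral.integral_neg, ← h]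
      refine intervalIntegral.integral_congr fun x _ => ?_
      rw [Nat.cast_natAbs, abs_of_nonpos h0, Int.cast_neg, neg_mul, Real.sin_neg, mul_neg]
  have hic : IntervalIntegrable (fun x => ((f x * Real.cos (j * x) : ℝ) : ℂ)) volume
      (-Real.pi) Real.pi := Continuous.intervalIntegrable (by fun_prop) _ _
  have his : IntervalIntegrable (fun x => -Complex.I * ((f x * Real.sin (j * x) : ℝ) : ℂ)) volume
      (-Real.pi) Real.pi := Continuous.intervalIntegrable (by fun_prop) _ _
  rw [fourierCoeff_eq_intervalIntegral _ _ (-Real.pi),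
    show -Real.pi + 2 * Real.pi = Real.pi by ring]
  have hsplit : ∫ x in (-Real.pi)..Real.pi, fourier (-j) (x : Circ) • toCirc hf hper (x : Circ)
      = ∫ x in (-Real.pi)..Real.pi, (((f x * Real.cos (j * x) : ℝ) : ℂ)
        + -Complex.I * ((f x * Real.sin (j * x) : ℝ) : ℂ)) := by
    refine intervalIntegral.integral_congr fun x _ => ?_
    simp only [smul_eq_mul]
    rw [toCirc_coe, fourier_coe_eq_exp, Int.cast_neg, neg_mul, Complex.exp_mul_I,
      ← Complex.ofReal_cos, ← Complex.ofReal_sin, Real.cos_neg, Real.sin_neg]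
    push_cast
    ring
  rw [hsplit, intervalIntegral.integral_add hic his, intervalIntegral.integral_const_mul,
    intervalIntegral.integral_ofReal, intervalIntegral.integral_ofReal, hcos, hsin]
  simp

theorem supNorm_le_of_mu_lt {n : ℕ} (hn : 1 ≤ n) (k : ℕ) (hf : Continuous f)
    (hper : Function.Periodic f (2 * Real.pi)) (horth : OrthTrigPoly (n - 1) f) {h : ℝ}
    (hh : 0 < h) (hlt : Real.pi * mu k / h < n) :
    supNorm f ≤ (Real.cos (Real.pi / 2 * (Real.pi * mu k / h / n)))⁻¹ *
      (gammaStar (2 * k) * modulus (2 * k) f h) := by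
  have hc0 : 0 ≤ Real.pi * mu k / h := by have := mu_nonneg k; positivity
  have hn0 : (0 : ℝ) < n := by exact_mod_cast hn
  have hspec : ∀ j : ℤ, fourierCoeff (toCirc hf hper) j ≠ 0 → (n : ℝ) ≤ |(j : ℝ)| := fun j hj => by
    by_contra hcon
    refine hj (fourierCoeff_toCirc_eq_zero hf hper horth ?_)
    rw [not_le, ← Int.cast_abs, ← Nat.cast_natAbs, Nat.cast_lt] at hcon
    lia
  have hw : ∀ j, fourierCoeff (averagedDiff k h (toCirc hf hper)) j =
      (1 - ((∑ i ∈ Finset.range k, diffWeight k h i *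
        (2 - 2 * Real.cos (j * ((i + 1 : ℝ) * h))) : ℝ) : ℂ) * ((j : ℂ) ^ 2)⁻¹) *
      fourierCoeff (toCirc hf hper) j := fun j => by
    rw [hasMultiplier_averagedDiff]
    beta_reduce
    -- The symbol formula fails at `j = 0`, where division by `j²` is division by zero; but that
    -- frequency is absent from `f` because `n ≥ 1`.
    rcases eq_or_ne (fourierCoeff (toCirc hf hper) j) 0 with h0 | h0
    · rw [h0, mul_zero, mul_zero]
    · have hj : j ≠ 0 := fun hj => by
        have := hspec j h0
        rw [hj, Int.cast_zero, abs_zero] at this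
        linarith
      rw [averagedDiff_symbol k hh hj]
  refine (supNorm_le_norm_toCirc hf hper).trans ((norm_le_inv_cos_mul hn
    (hasMultiplier_secondDiff k (diffWeight k h) h) hspec hw hc0 hlt
    (norm_secondDiff_diffWeight_le k hh)).trans ?_)
  refine mul_le_mul_of_nonneg_left (norm_averagedDiff_le hf hper k hh) (inv_nonneg.2 ?_)
  have h1 : Real.pi * mu k / h / n < 1 := (div_lt_one hn0).2 hlt
  have h2 : 0 ≤ Real.pi * mu k / h / n := by positivity
  refine Real.cos_nonneg_of_mem_Icc ⟨?_, ?_⟩ <;> nlinarith [Real.pi_pos]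

end Function

end BohrFavard

/-! ### The two estimates. -/

theorem mainTheorem4 (n k : ℕ) (hn : 1 ≤ n) (hk : 1 ≤ k) (f : ℝ → ℝ) (hf : Continuous f)
    (hper : Function.Periodic f (2 * Real.pi)) (horth : BohrFavard.OrthTrigPoly (n - 1) f) :
    (∀ α : ℝ, 1 < α →
      BohrFavard.supNorm f ≤ (Real.cos (Real.pi / (2 * α)))⁻¹ * BohrFavard.gammaStar (2 * k) *
        BohrFavard.modulus (2 * k) f (α * Real.pi / n)) ∧
    (∀ h ρ : ℝ, Real.pi / n * BohrFavard.mu k < h → ρ = Real.pi * BohrFavard.mu k / (n * h) →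
      ρ < 1 ∧
      BohrFavard.supNorm f ≤ (Real.cos (Real.pi / 2 * ρ))⁻¹ * BohrFavard.gammaStar (2 * k) *
        BohrFavard.modulus (2 * k) f h) := by
  have hn0 : (0 : ℝ) < n := by exact_mod_cast hn
  have hmu := BohrFavard.mu_nonneg k
  have hmain : ∀ h ρ : ℝ, Real.pi / n * BohrFavard.mu k < h →
      ρ = Real.pi * BohrFavard.mu k / (n * h) → ρ < 1 ∧
      BohrFavard.supNorm f ≤ (Real.cos (Real.pi / 2 * ρ))⁻¹ * (BohrFavard.gammaStar (2 * k) *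
        BohrFavard.modulus (2 * k) f h) := fun h ρ hlt hρ => by
    have hh : 0 < h := lt_of_le_of_lt (by positivity) hlt
    have hlt' : Real.pi * BohrFavard.mu k < h * n := by
      rwa [div_mul_eq_mul_div, div_lt_iff₀ hn0] at hlt
    have hρ' : ρ = Real.pi * BohrFavard.mu k / h / n := by rw [hρ, div_div, mul_comm h]
    have hlt2 : Real.pi * BohrFavard.mu k / h < n := by
      rw [div_lt_iff₀ hh]; linarith
    refine ⟨?_, ?_⟩
    · rw [hρ']; exact (div_lt_one hn0).2 hlt2
    · rw [hρ']; exact BohrFavard.supNorm_le_of_mu_lt hn k hf hper horth hh hlt2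
  refine ⟨fun α hα => ?_, fun h ρ hlt hρ => ?_⟩
  · have hα0 : 0 < α := by linarith
    have hπ := Real.pi_pos
    have hmu1 := BohrFavard.mu_le_one k
    -- For this step `ρ = μ/α ≤ 1/α`, and the secant increases on `[0, π/2)`.
    obtain ⟨h1, h2⟩ := hmain (α * Real.pi / n) (BohrFavard.mu k / α) (by
      rw [div_mul_eq_mul_div, div_lt_div_iff_of_pos_right hn0]
      nlinarith) (by field_simp)
    rw [mul_assoc]
    refine h2.trans (mul_le_mul_of_nonneg_right ?_ (mul_nonneg (BohrFavard.gammaStar_nonneg _) ?_))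
    · have hle : Real.pi / 2 * (BohrFavard.mu k / α) ≤ Real.pi / (2 * α) := by
        rw [div_mul_div_comm]
        exact div_le_div_of_nonneg_right (by nlinarith) (by positivity)
      have hlt : Real.pi / (2 * α) < Real.pi / 2 := by
        apply div_lt_div_of_pos_left hπ two_pos; linarith
      refine inv_anti₀ (Real.cos_pos_of_mem_Ioo ⟨?_, hlt⟩)
        (Real.cos_le_cos_of_nonneg_of_le_pi (by positivity) (by linarith) hle)
      exact lt_of_lt_of_le (by linarith) (by positivity : (0 : ℝ) ≤ Real.pi / (2 * α))
    · exact (abs_nonneg _).trans (BohrFavard.abs_fwdDelta_le_modulus hf hper (2 * k)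
        (h := α * Real.pi / n) ⟨by positivity, le_rfl⟩ 0)
  · obtain ⟨h1, h2⟩ := hmain h ρ hlt hρ
    exact ⟨h1, by rw [mul_assoc]; exact h2⟩
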